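/- Let $\mathcal G=(\mathcal V,\mathcal E)$, $\mathcal V=\{1,\dots,n\}$, be an undirected connected graph, let $f_1,\dots,f_n:\mathbb R^d\to\mathbb R$ be $\mu$-strongly convex and $L$-smooth (differentiable with $L$-Lipschitz gradient), $\mu>0$, and put $\kappa=L/\mu$ and $F(x_1,\dots,x_n)=\sum_i f_i(x_i)$ on $(\mathbb R^d)^{\mathcal V}$ with its Euclidean norm. Let $\hat{\mathbf W}\in\mathbb R^{n\times n}$ be a gossip matrix of $\mathcal G$: symmetric positive semidefinite, $\hat{\mathbf W}_{ij}\ne0$ if and only if $i=j$ or $(i,j)\in\mathcal E$, and $\ker\hat{\mathbf W}=\mathrm{span}(1,\dots,1)$. Let $\mathbf W=\hat{\mathbf W}\otimes \mathbf I_d$, let $\lambda_{\max}(\mathbf W)$ and $\lambda_{\min}^+(\mathbf W)$ be its largest and its smallest positive eigenvalue, and assume that $\chi=\lambda_{\max}(\mathbf W)/\lambda_{\min}^+(\mathbf W)>1$. Let $x^*$ minimize $F$ over $\ker\mathbf W$, and let $\mathrm D_F(x,x')=F(x)-F(x')-\langle\nabla F(x'),x-x'\rangle$. Set $$T=\lfloor\sqrt\chi\rfloor,\quad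 c_1=\frac{\sqrt\chi-1}{\sqrt\chi+1},\quad c_2=\frac{\chi+1}{\chi-1},\quad c_3=\frac{2\chi}{(1+\chi)\lambda_{\max}(\mathbf W)},$$ $$\tau=\min\Big\{1,\frac{1+c_1^T}{2\sqrt\kappa(1-c_1^T)}\Big\},\quad \eta=\frac1{4\tau L},\quad \theta=\frac{1+c_1^{2T}}{\eta(1+c_1^T)^2},\quad \alpha=\mu .$$ The procedure $\mathrm{AcceleratedGossip}(\mathbf W,x,T)$ sets $a_0=1$, $a_1=c_2$, $x_0=x$, $x_1=c_2(I-c_3\mathbf W)x$, computes $a_{i+1}=2c_2a_i-a_{i-1}$ and $x_{i+1}=2c_2(I-c_3\mathbf W)x_i-x_{i-1}$ for $i=1,\dots,T-1$, and returns $x-x_T/a_T$; this is a polynomial $P(\mathbf W)$ applied to $x$. OPAPC starts from any $x^0=x_f^0\in(\mathbb R^d)^{\mathcal V}$ and any $y^0\in\mathrm{range}\,P(\mathbf W)$ and iterates, for $k=0,1,2,\dots$, $$x_g^k=\tau x^k+(1-\tau)x_f^k,\qquad x^{k+1/2}=(1+\eta\alpha)^{-1}\big(x^k-\eta(\nabla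 F(x_g^k)-\alpha x_g^k+y^k)\big),$$ $$y^{k+1}=y^k+\theta\,\mathrm{AcceleratedGossip}(\mathbf W,x^{k+1/2},T),$$ $$x^{k+1}=(1+\eta\alpha)^{-1}\big(x^k-\eta(\nabla F(x_g^k)-\alpha x_g^k+y^{k+1})\big),\qquad x_f^{k+1}=x_g^k+\tfrac{2\tau}{2-\tau}(x^{k+1}-x^k).$$ One gradient computation is one evaluation of $\nabla F$, and one communication round is one multiplication by $\mathbf W$. Then there is a constant $C\ge0$, independent of $k$, such that for all $k\ge0$ $$\frac1\eta\|x^k-x^*\|^2+\frac{2(1-\tau)}{\tau}\mathrm D_F(x_f^k,x^*)\le\Big(1+\tfrac1{16}\min\Big\{\frac2{\sqrt\kappa},1\Big\}\Big)^{-k}C .$$ Moreover, with an absolute constant $K$ and the same $C$, for every $\varepsilon>0$ there is a $k$ such that $\|x^j-x^*\|^2\le\varepsilon$ for all $j\ge k$ and the first $k$ iterations use at most $K\sqrt\kappa\,(1+\max\{0,\log(\eta C/\varepsilon)\})$ gradient computations and at most $K\sqrt{\kappa\chi}\,(1+\max\{0,\log(\eta C/\varepsilon)\})$ communication rounds. In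 particular, for all sufficiently small $\varepsilon>0$ (how small depends on the problem and the starting point) such a $k$ exists with at most $K\sqrt\kappa\log(1/\varepsilon)$ gradient computations and at most $K\sqrt{\kappa\chi}\log(1/\varepsilon)$ communication rounds; that is, OPAPC needs $O(\sqrt\kappa\log(1/\varepsilon))$ gradient computations and $O(\sqrt{\kappa\chi}\log(1/\varepsilon))$ communication rounds. -/

import Mathlib

noncomputable section

namespace OPAPC

/-! ### The decentralized problem -/

/-- The lifted space `(ℝ^d)^𝒱`, `𝒱 = {1, …, n}`, with its Euclidean norm. -/
abbrev Lifted (n d : ℕ) : Type := PiLp 2 (fun _ : Fin n => EuclideanSpace ℝ (Fin d))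

/-- `f` is `μ`-strongly convex and `L`-smooth. -/
structure IsSmoothStronglyConvex {d : ℕ} (L μ : ℝ) (f : EuclideanSpace ℝ (Fin d) → ℝ) :
    Prop where
  strongConvex : StrongConvexOn Set.univ μ f
  differentiable : Differentiable ℝ f
  lipschitz_gradient : ∀ x y, ‖gradient f x - gradient f y‖ ≤ L * ‖x - y‖

/-- `F (x₁, …, xₙ) = ∑ i, f i (x i)`. -/
def sumObjective {n d : ℕ} (f : Fin n → EuclideanSpace ℝ (Fin d) → ℝ) : Lifted n d → ℝ :=
  fun x => ∑ i, f i (x i)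

/-- The Bregman divergence `D_F (x, y) = F x - F y - ⟪∇F y, x - y⟫`. -/
def bregman {n d : ℕ} (F : Lifted n d → ℝ) (x y : Lifted n d) : ℝ :=
  F x - F y - inner ℝ (gradient F y) (x - y)

/-- `M` is a gossip matrix of the graph `G`: symmetric positive semidefinite, nonzero exactly on
the diagonal and on the edges, with kernel spanned by the all-ones vector. -/
structure IsGossipMatrix {n : ℕ} (G : SimpleGraph (Fin n)) (M : Matrix (Fin n) (Fin n) ℝ) :
    Prop where
  posSemidef : M.PosSemidef
  support : ∀ i j, M i j ≠ 0 ↔ i = j ∨ G.Adj i j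
  ker : ∀ v : Fin n → ℝ, M.mulVec v = 0 ↔ v ∈ Submodule.span ℝ {(1 : Fin n → ℝ)}

/-- The operator `W = M ⊗ I_d` on `(ℝ^d)^𝒱`. -/
def gossipOp {n : ℕ} (d : ℕ) (M : Matrix (Fin n) (Fin n) ℝ) : Lifted n d →ₗ[ℝ] Lifted n d where
  toFun x := WithLp.toLp 2 (fun i => ∑ j, M i j • x j)
  map_add' x y := by
    ext i t
    simp [Finset.sum_add_distrib]
  map_smul' c x := by
    ext i t
    simp [Finset.mul_sum, mul_left_comm]

/-- The largest eigenvalue. -/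
def lambdaMax {n d : ℕ} (W : Lifted n d →ₗ[ℝ] Lifted n d) : ℝ :=
  sSup {t : ℝ | Module.End.HasEigenvalue W t}

/-- The smallest positive eigenvalue. -/
def lambdaMinPos {n d : ℕ} (W : Lifted n d →ₗ[ℝ] Lifted n d) : ℝ :=
  sInf {t : ℝ | Module.End.HasEigenvalue W t ∧ 0 < t}

/-- The condition number `χ(W) = λ_max(W) / λ_min⁺(W)`. -/
def chi {n d : ℕ} (W : Lifted n d →ₗ[ℝ] Lifted n d) : ℝ :=
  lambdaMax W / lambdaMinPos W

/-- `x` solves the problem of minimizing `F` over the kernel of `W`. -/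
def IsSolution {n d : ℕ} (F : Lifted n d → ℝ) (W : Lifted n d →ₗ[ℝ] Lifted n d)
    (x : Lifted n d) : Prop :=
  W x = 0 ∧ ∀ z, W z = 0 → F x ≤ F z

/-! ### Oracle programs

A program over the vector space `E` reaches the objective only by asking for the gradient at a
point, and the network only by asking for the product of the gossip matrix with a vector. -/

inductive Prog (E : Type) (α : Type) : Type where
  /-- Stop and return a value. -/
  | ret (a : α) : Prog E α
  /-- One gradient computation at `x`; the program continues with the answer. -/
  | grad (x : E) (next : E → Prog E α) : Prog E α
  /-- One communication round applied to `x`; the program continues with the answer. -/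
  | comm (x : E) (next : E → Prog E α) : Prog E α

namespace Prog

variable {E α β : Type}

/-- Sequential composition. -/
def bind (p : Prog E α) (q : α → Prog E β) : Prog E β :=
  match p with
  | ret a => q a
  | grad x next => grad x (fun v => (next v).bind q)
  | comm x next => comm x (fun v => (next v).bind q)

/-- The value returned when the oracles are `g` (gradient) and `w` (communication). -/
def eval (g w : E → E) : Prog E α → α
  | ret a => a
  | grad x next => (next (g x)).eval g w
  | comm x next => (next (w x)).eval g w

/-- The number of gradient computations in the execution with the oracles `g` and `w`. -/
def gradCount (g w : E → E) : Prog E α → ℕ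
  | ret _ => 0
  | grad x next => (next (g x)).gradCount g w + 1
  | comm x next => (next (w x)).gradCount g w

/-- The number of communication rounds in the execution with the oracles `g` and `w`. -/
def commCount (g w : E → E) : Prog E α → ℕ
  | ret _ => 0
  | grad x next => (next (g x)).commCount g w
  | comm x next => (next (w x)).commCount g w + 1

end Prog

/-! ### The algorithm -/

section Algorithm

variable {E : Type} [AddCommGroup E] [Module ℝ E]

/-- `chebyshevLoop c₂ c₃ m a' a z' z` performs `m` iterations of the loop of `acceleratedGossip`
from `a_{i-1} = a'`, `a_i = a`, `x_{i-1} = z'`, `x_i = z`, and returns the last `a` and `x`. -/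
def chebyshevLoop (c₂ c₃ : ℝ) : ℕ → ℝ → ℝ → E → E → Prog E (ℝ × E)
  | 0, _, a, _, z => Prog.ret (a, z)
  | m + 1, a', a, z', z =>
      Prog.comm z (fun Wz =>
        chebyshevLoop c₂ c₃ m a (2 * c₂ * a - a') z ((2 * c₂) • (z - c₃ • Wz) - z'))

/-- `AcceleratedGossip(W, x, T)` for `T ≥ 1`: from `a_0 = 1`, `a_1 = c₂`, `x_0 = x`,
`x_1 = c₂ (I - c₃ W) x`, the loop is run for `i = 1, …, T - 1`, and `x - x_T / a_T` is returned. -/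
def acceleratedGossip (c₂ c₃ : ℝ) (T : ℕ) (x : E) : Prog E E :=
  Prog.comm x (fun Wx =>
    (chebyshevLoop c₂ c₃ (T - 1) 1 c₂ x (c₂ • (x - c₃ • Wx))).bind
      (fun r => Prog.ret (x - r.1⁻¹ • r.2)))

/-- The variables `x^k`, `x_f^k`, `y^k`. -/
structure State (E : Type) where
  x : E
  xf : E
  y : E

/-- One iteration of OPAPC. -/
def step (T : ℕ) (c₂ c₃ η θ α τ : ℝ) (s : State E) : Prog E (State E) :=
  let xg : E := τ • s.x + (1 - τ) • s.xf
  Prog.grad xg (fun g =>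
    let xhalf : E := (1 + η * α)⁻¹ • (s.x - η • (g - α • xg + s.y))
    (acceleratedGossip c₂ c₃ T xhalf).bind (fun v =>
      let y' : E := s.y + θ • v
      let x' : E := (1 + η * α)⁻¹ • (s.x - η • (g - α • xg + y'))
      Prog.ret { x := x', xf := xg + (2 * τ / (2 - τ)) • (x' - s.x), y := y' }))

/-- OPAPC from `x^0 = x_f^0 = x₀` and `y^0 = y₀`, stopped after `k` iterations. -/
def opapc (T : ℕ) (c₂ c₃ η θ α τ : ℝ) (x₀ y₀ : E) : ℕ → Prog E (State E)
  | 0 => Prog.ret { x := x₀, xf := x₀, y := y₀ }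
  | k + 1 => (opapc T c₂ c₃ η θ α τ x₀ y₀ k).bind (step T c₂ c₃ η θ α τ)

end Algorithm

end OPAPC

end

/-!
# Linear convergence and complexity of OPAPC

Accelerated gossip evaluates a polynomial in `W`: since the recursion for `a_i` and `x_i` is that of
the Chebyshev polynomials, `AcceleratedGossip(W, x, T) = P(W) x` with
`P(t) = 1 - T_T(c₂ (1 - c₃ t)) / T_T(c₂)` (`OPAPC.eval_acceleratedGossip`). The affine map
`t ↦ c₂ (1 - c₃ t)` sends `[λ_min⁺, λ_max]` to `[-1, 1]`, and `T_T(c₂) = (q + q⁻¹) / 2` with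
`q = c₁ ^ T`, so `P` vanishes at `0` and maps the positive spectrum of `W` into `[l₁, l₂]`, where
`l₁ = (1 - q)² / (1 + q²)` and `l₂ = (1 + q)² / (1 + q²)` (`OPAPC.eval_gossipPoly_mem_Icc`). By
Bernoulli's inequality, `T = ⌊√χ⌋` rounds give `q ≤ 1 / 3`, hence `l₂ / l₁ ≤ 4`
(`OPAPC.chebyshev_base_pow_floor_le`).

It remains to analyse an accelerated primal-dual method for the constraint `P(W) x = 0`, whose
condition number is at most `4`. The solution satisfies `∇F(x*) ∈ (ker W)ᗮ`, so there is a dual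
solution `-∇F(x*) = P(W) z*`. The Lyapunov function (`OPAPC.lyapunov`) is the quantity bounded in
the theorem plus a dual energy of the error of `y = P(W) z`, with `y` measured through the preimage
`z` instead of the pseudo-inverse of `P(W)`. In one step, smoothness and strong convexity at the
extrapolated point (`accelerated_step_energy`) together with the dual update (`dualEnergy_step`)
show that the Lyapunov function decreases up to leftover negative terms in the primal displacement
and in the gradient difference. The primal update expresses the new dual error through these vectors
(`dual_error_le_leftover`), so the leftover terms absorb a fraction of the dual energy, and the
Lyapunov function contracts by the factor `1 + δ`, `δ = min (2 / √κ) 1 / 16`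
(`lyapunov_contraction`; the numerical conditions on the step sizes are `OPAPC.step_size_bounds`).

An iteration costs one gradient and `T ≤ √χ` communication rounds, and `1 / δ ≤ 16 √κ`, which turns
the linear rate into the two complexity bounds (`OPAPC.exists_iteration_count`).
-/

open Polynomial Filter Topology

/-! ### Smooth and strongly convex functions -/

section SmoothConvex

variable {E : Type*} [NormedAddCommGroup E] [InnerProductSpace ℝ E] [CompleteSpace E]
  {f : E → ℝ} {L μ : ℝ}

theorem hasDerivAt_comp_line_of_hasGradientAt {g y d : E} {t : ℝ}
    (hf : HasGradientAt f g (y + t • d)) :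
    HasDerivAt (fun s : ℝ => f (y + s • d)) (inner ℝ g d) t := by
  have h1 : HasDerivAt (fun s : ℝ => y + s • d) d t := by
    simpa using ((hasDerivAt_id t).smul_const d).const_add y
  have h2 := hf.hasFDerivAt.comp_hasDerivAt t h1
  simpa [Function.comp_def] using h2

/-- First-order characterization of strong convexity: the function lies above its tangent
paraboloids. -/
theorem strongConvexOn_lower_bound (hf : StrongConvexOn Set.univ μ f) {g y : E}
    (hg : HasGradientAt f g y) (x : E) :
    f y + inner ℝ g (x - y) + μ / 2 * ‖x - y‖ ^ 2 ≤ f x := by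
  have hd : HasDerivAt (fun s : ℝ => f (y + s • (x - y))) (inner ℝ g (x - y)) 0 :=
    hasDerivAt_comp_line_of_hasGradientAt (by simpa using hg)
  have hlim := hd.tendsto_slope_zero_right
  have hrhs : Tendsto (fun t : ℝ => f x - f y - (1 - t) * (μ / 2 * ‖x - y‖ ^ 2)) (𝓝[>] 0)
      (𝓝 (f x - f y - (1 - 0) * (μ / 2 * ‖x - y‖ ^ 2))) := by
    apply Tendsto.mono_left _ nhdsWithin_le_nhds
    apply Continuous.tendsto
    fun_prop
  have hle := le_of_tendsto_of_tendsto hlim hrhs (by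
    filter_upwards [Ioo_mem_nhdsGT (show (0 : ℝ) < 1 by norm_num)] with t ht
    have hc := hf.2 (Set.mem_univ y) (Set.mem_univ x)
      (sub_nonneg.2 ht.2.le) ht.1.le (sub_add_cancel 1 t)
    have hpt : (1 - t) • y + t • x = y + t • (x - y) := by module
    rw [hpt, norm_sub_rev] at hc
    simp only [smul_eq_mul, zero_add, zero_smul, add_zero] at hc ⊢
    rw [inv_mul_le_iff₀ ht.1]
    linarith)
  linarith

/-- The descent lemma: a function with an `L`-Lipschitz gradient lies below its tangent
paraboloids. -/
theorem lipschitz_gradient_upper_bound (hf : Differentiable ℝ f)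
    (hL : ∀ x y, ‖gradient f x - gradient f y‖ ≤ L * ‖x - y‖) (x y : E) :
    f x ≤ f y + inner ℝ (gradient f y) (x - y) + L / 2 * ‖x - y‖ ^ 2 := by
  set d := x - y with hd
  have hderiv : ∀ t : ℝ, HasDerivAt
      (fun s : ℝ => f (y + s • d) - s * inner ℝ (gradient f y) d - s ^ 2 * (L / 2 * ‖d‖ ^ 2))
      (inner ℝ (gradient f (y + t • d)) d - inner ℝ (gradient f y) d - t * (L * ‖d‖ ^ 2)) t := by
    intro t
    have h1 := hasDerivAt_comp_line_of_hasGradientAt (hf (y + t • d)).hasGradientAt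
    have h2 := (hasDerivAt_id t).mul_const (inner ℝ (gradient f y) d)
    have h3 := (hasDerivAt_pow 2 t).mul_const (L / 2 * ‖d‖ ^ 2)
    refine ((h1.sub h2).sub h3).congr_deriv ?_
    norm_num
    ring
  have hanti := antitoneOn_of_deriv_nonpos (convex_Icc (0 : ℝ) 1)
    (fun t _ => (hderiv t).continuousAt.continuousWithinAt)
    (fun t _ => (hderiv t).differentiableAt.differentiableWithinAt)
    (by
      intro t ht
      rw [interior_Icc] at ht
      rw [(hderiv t).deriv, ← inner_sub_left]
      have h1 := real_inner_le_norm (gradient f (y + t • d) - gradient f y) d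
      have h2 := hL (y + t • d) y
      rw [add_sub_cancel_left, norm_smul, Real.norm_eq_abs, abs_of_pos ht.1] at h2
      have h3 := mul_le_mul_of_nonneg_right h2 (norm_nonneg d)
      nlinarith)
  have h := hanti (Set.left_mem_Icc.2 zero_le_one) (Set.right_mem_Icc.2 zero_le_one) zero_le_one
  simp only [one_smul, zero_smul, add_zero, zero_mul, one_mul, sub_zero, one_pow, ne_eq,
    OfNat.ofNat_ne_zero, not_false_eq_true, zero_pow] at h
  have hx : y + d = x := by rw [hd]; abel
  rw [hx] at h
  linarith

/-- Cocoercivity of the gradient of a smooth convex function. It results from comparing, at the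
gradient step `x - L⁻¹ (∇f x - ∇f y)`, the tangent paraboloid at `x` with the tangent at `y`. -/
theorem gradient_cocoercive (hc : ConvexOn ℝ Set.univ f) (hf : Differentiable ℝ f) (hL0 : 0 < L)
    (hL : ∀ x y, ‖gradient f x - gradient f y‖ ≤ L * ‖x - y‖) (x y : E) :
    1 / (2 * L) * ‖gradient f x - gradient f y‖ ^ 2
      ≤ f x - f y - inner ℝ (gradient f y) (x - y) := by
  set g := gradient f x - gradient f y with hg
  have h1 := lipschitz_gradient_upper_bound hf hL (x - L⁻¹ • g) x
  have h2 := strongConvexOn_lower_bound (strongConvexOn_zero.2 hc) (hf y).hasGradientAt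
    (x - L⁻¹ • g)
  have e1 : x - L⁻¹ • g - x = -(L⁻¹ • g) := by abel
  have e2 : x - L⁻¹ • g - y = (x - y) - L⁻¹ • g := by abel
  have e3 : L⁻¹ * inner ℝ (gradient f x) g - L⁻¹ * inner ℝ (gradient f y) g
      = L⁻¹ * ‖g‖ ^ 2 := by
    rw [← mul_sub, ← inner_sub_left, ← hg, real_inner_self_eq_norm_sq]
  rw [e1, norm_neg, norm_smul, inner_neg_right, real_inner_smul_right, mul_pow, Real.norm_eq_abs,
    sq_abs] at h1
  rw [e2, inner_sub_right, real_inner_smul_right] at h2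
  have e4 : L / 2 * (L⁻¹ ^ 2 * ‖g‖ ^ 2) = 1 / (2 * L) * ‖g‖ ^ 2 := by field_simp
  have e5 : L⁻¹ * ‖g‖ ^ 2 = 1 / (2 * L) * ‖g‖ ^ 2 + 1 / (2 * L) * ‖g‖ ^ 2 := by
    field_simp; norm_num
  linarith

end SmoothConvex

section SumObjective

namespace OPAPC

variable {n d : ℕ} {f : Fin n → EuclideanSpace ℝ (Fin d) → ℝ} {L μ : ℝ}

theorem hasGradientAt_sumObjective (hf : ∀ i, Differentiable ℝ (f i)) (x : Lifted n d) :
    HasGradientAt (sumObjective f) (WithLp.toLp 2 fun i => gradient (f i) (x i)) x := by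
  rw [hasGradientAt_iff_hasFDerivAt]
  have h : HasFDerivAt (fun z : Lifted n d => ∑ i, f i (z i)) _ x :=
    HasFDerivAt.fun_sum fun i _ => (hf i (x i)).hasGradientAt.hasFDerivAt.comp x
      (PiLp.hasFDerivAt_apply (𝕜 := ℝ) 2 x i)
  refine h.congr_fderiv ?_
  ext z
  simp [PiLp.inner_apply]

theorem gradient_sumObjective (hf : ∀ i, Differentiable ℝ (f i)) (x : Lifted n d) :
    gradient (sumObjective f) x = WithLp.toLp 2 fun i => gradient (f i) (x i) :=
  (hasGradientAt_sumObjective hf x).gradient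

theorem strongConvexOn_sumObjective (hf : ∀ i, StrongConvexOn Set.univ μ (f i)) :
    StrongConvexOn Set.univ μ (sumObjective f) := by
  refine ⟨convex_univ, fun x _ y _ a b ha hb hab => ?_⟩
  have h := Finset.sum_le_sum fun i (_ : i ∈ Finset.univ) =>
    (hf i).2 (Set.mem_univ (x i)) (Set.mem_univ (y i)) ha hb hab
  have hn : ‖x - y‖ ^ 2 = ∑ i, ‖x i - y i‖ ^ 2 := by
    simp [PiLp.norm_sq_eq_of_L2]
  simp only [sumObjective, hn, smul_eq_mul, Finset.sum_sub_distrib, Finset.sum_add_distrib,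
    ← Finset.mul_sum] at h ⊢
  simpa using h

theorem gradient_sumObjective_lipschitz (hL0 : 0 ≤ L) (hf : ∀ i, Differentiable ℝ (f i))
    (hL : ∀ i x y, ‖gradient (f i) x - gradient (f i) y‖ ≤ L * ‖x - y‖) (x y : Lifted n d) :
    ‖gradient (sumObjective f) x - gradient (sumObjective f) y‖ ≤ L * ‖x - y‖ := by
  refine le_of_sq_le_sq ?_ (by positivity)
  rw [mul_pow, PiLp.norm_sq_eq_of_L2, PiLp.norm_sq_eq_of_L2, Finset.mul_sum]
  refine Finset.sum_le_sum fun i _ => ?_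
  rw [gradient_sumObjective hf, gradient_sumObjective hf, ← mul_pow]
  exact pow_le_pow_left₀ (norm_nonneg _) (hL i (x i) (y i)) 2

end OPAPC

end SumObjective

/-! ### Energy estimates for a primal-dual step -/

section PrimalDual

variable {E : Type*} [NormedAddCommGroup E] [InnerProductSpace ℝ E]

/-- The dual part of the Lyapunov function, at a dual error `P ζ`. It stands for
`θ⁻¹ ⟪v, P⁺ v⟫ - η / (1 + η α) ‖v‖ ^ 2` with `v = P ζ` and `θ = 1 / (η l₂)`; carrying the preimage
`ζ` along avoids the pseudo-inverse `P⁺`. -/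
noncomputable def dualEnergy (P : E →ₗ[ℝ] E) (η α l₂ : ℝ) (ζ : E) : ℝ :=
  η * l₂ * inner ℝ ζ (P ζ) - η / (1 + η * α) * ‖P ζ‖ ^ 2

variable {P : E →ₗ[ℝ] E} {η α l₁ l₂ : ℝ}

theorem dualEnergy_nonneg (hη : 0 < η) (hα : 0 < α)
    (hup : ∀ z, ‖P z‖ ^ 2 ≤ l₂ * inner ℝ z (P z)) (ζ : E) : 0 ≤ dualEnergy P η α l₂ ζ := by
  have h1 : η / (1 + η * α) ≤ η := div_le_self hη.le (by nlinarith [mul_pos hη hα])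
  have h2 := mul_le_mul_of_nonneg_right h1 (sq_nonneg ‖P ζ‖)
  have h3 := mul_le_mul_of_nonneg_left (hup ζ) hη.le
  unfold dualEnergy
  linarith

theorem dualEnergy_le (hη : 0 < η) (hα : 0 < α) (hl₁ : 0 < l₁) (hl₂ : 0 < l₂)
    (hlow : ∀ z, l₁ * inner ℝ z (P z) ≤ ‖P z‖ ^ 2) (ζ : E) :
    dualEnergy P η α l₂ ζ ≤ η * (l₂ / l₁) * ‖P ζ‖ ^ 2 := by
  have h1 : 0 ≤ η / (1 + η * α) * ‖P ζ‖ ^ 2 := by positivity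
  have h2 : inner ℝ ζ (P ζ) ≤ ‖P ζ‖ ^ 2 / l₁ := by
    rw [le_div_iff₀ hl₁, mul_comm]; exact hlow ζ
  have h3 := mul_le_mul_of_nonneg_left h2 (mul_pos hη hl₂).le
  have h4 : η * l₂ * (‖P ζ‖ ^ 2 / l₁) = η * (l₂ / l₁) * ‖P ζ‖ ^ 2 := by ring
  unfold dualEnergy
  linarith

/-- The dual step `ζ' = ζ + θ x^{k+1/2}` decreases the dual energy, up to the coupling term
`⟪P ζ', u⟫` with the primal error `u` of the corrected iterate. -/
theorem dualEnergy_step (hP : P.IsSymmetric) (hη : 0 < η) (hα : 0 < α)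
    (hup : ∀ z, ‖P z‖ ^ 2 ≤ l₂ * inner ℝ z (P z)) {ζ ζ' u : E}
    (hu : P u = (η * l₂) • P (ζ' - ζ) - (η / (1 + η * α)) • P (P (ζ' - ζ))) :
    dualEnergy P η α l₂ ζ' ≤ dualEnergy P η α l₂ ζ + 2 * inner ℝ (P ζ') u := by
  obtain ⟨D, rfl⟩ : ∃ D, ζ = ζ' - D := ⟨ζ' - ζ, by abel⟩
  rw [sub_sub_cancel] at hu
  have hn := dualEnergy_nonneg hη hα hup D
  have h1 : inner ℝ (P ζ') u
      = η * l₂ * inner ℝ ζ' (P D) - η / (1 + η * α) * inner ℝ (P ζ') (P D) := by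
    rw [hP ζ' u, hu, inner_sub_right, real_inner_smul_right, real_inner_smul_right, hP ζ' (P D)]
  have h2 : inner ℝ (ζ' - D) (P (ζ' - D))
      = inner ℝ ζ' (P ζ') - 2 * inner ℝ ζ' (P D) + inner ℝ D (P D) := by
    have : inner ℝ D (P ζ') = inner ℝ ζ' (P D) := by rw [← hP D ζ', real_inner_comm]
    rw [map_sub, inner_sub_left, inner_sub_right, inner_sub_right, this]
    ring
  have h3 : ‖P (ζ' - D)‖ ^ 2 = ‖P ζ'‖ ^ 2 - 2 * inner ℝ (P ζ') (P D) + ‖P D‖ ^ 2 := by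
    rw [map_sub, norm_sub_sq_real]
  unfold dualEnergy at hn ⊢
  rw [h1, h2, h3]
  linarith

/-- The energy balance of one accelerated step, in terms of the errors `r` and `u` of the old and
the new iterate, `w` of the extrapolated point, and the gradient difference `g` there.
`Dg`, `Df`, `Df'` are the Bregman divergences to the solution of the extrapolated point and of the
old and the new averaged iterate, `s` and `s'` the steps from the extrapolated point to the latter
two. -/
theorem accelerated_step_energy {L τ Dg Df Df' : ℝ} {r u w g s s' v : E} (hη : 0 < η)
    (hL : 0 < L) (hτ : 0 < τ) (hτ1 : τ ≤ 1) (hηL : η = 1 / (4 * τ * L))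
    (hu : u - r = -η • (g - α • w + v + α • u))
    (hr : τ • (r - w) = -(1 - τ) • s)
    (hs' : s' = (2 * τ / (2 - τ)) • (u - r))
    (hcoc : 1 / (2 * L) * ‖g‖ ^ 2 ≤ Dg)
    (hmon : Dg + α / 2 * ‖w‖ ^ 2 ≤ inner ℝ g w)
    (hconv : inner ℝ g s ≤ Df - Dg)
    (hsmooth : Df' - Dg - L / 2 * ‖s'‖ ^ 2 ≤ inner ℝ g s') :
    (1 / η + α) * ‖u‖ ^ 2 + (2 - τ) / τ * Df' + 2 * inner ℝ v u
        + (1 / (2 * η) * ‖u - r‖ ^ 2 + α * ‖w - u‖ ^ 2 + 1 / (2 * L) * ‖g‖ ^ 2)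
      ≤ 1 / η * ‖r‖ ^ 2 + 2 * (1 - τ) / τ * Df := by
  have hτ2 : 0 < 2 - τ := by linarith
  have e1 : ‖r‖ ^ 2 = ‖u‖ ^ 2 - 2 * inner ℝ (u - r) u + ‖u - r‖ ^ 2 := by
    have : r = u - (u - r) := by abel
    conv_lhs => rw [this, norm_sub_sq_real, real_inner_comm]
  have e2 : inner ℝ (u - r) u
      = -η * (inner ℝ g u - α * inner ℝ w u + inner ℝ v u + α * ‖u‖ ^ 2) := by
    rw [hu, real_inner_smul_left, inner_add_left, inner_add_left, inner_sub_left,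
      real_inner_smul_left, real_inner_smul_left, real_inner_self_eq_norm_sq]
  have e3 : ‖w - u‖ ^ 2 = ‖w‖ ^ 2 - 2 * inner ℝ w u + ‖u‖ ^ 2 := norm_sub_sq_real w u
  have e4 : inner ℝ g u = inner ℝ g r + inner ℝ g (u - r) := by rw [inner_sub_right]; ring
  have e5 : inner ℝ g r = inner ℝ g w - (1 - τ) / τ * inner ℝ g s := by
    have h := congrArg (fun z => inner ℝ g z) hr
    simp only [real_inner_smul_right, inner_sub_right] at h
    field_simp
    linarith
  have e6 : 2 * inner ℝ g (u - r) = (2 - τ) / τ * inner ℝ g s' := by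
    rw [hs', real_inner_smul_right]
    field_simp
  have e7 : (2 - τ) / τ * (L / 2 * ‖s'‖ ^ 2) ≤ 1 / (2 * η) * ‖u - r‖ ^ 2 := by
    have hq : (2 - τ) / τ * (L / 2 * (2 * τ / (2 - τ)) ^ 2) ≤ 1 / (2 * η) := by
      have a1 : (2 - τ) / τ * (L / 2 * (2 * τ / (2 - τ)) ^ 2) = 2 * L * τ / (2 - τ) := by
        field_simp
      have a2 : 1 / (2 * η) = 2 * L * τ := by rw [hηL]; field_simp; norm_num
      rw [a1, a2]
      exact div_le_self (by positivity) (by linarith)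
    have h := mul_le_mul_of_nonneg_right hq (sq_nonneg ‖u - r‖)
    rw [hs', norm_smul, mul_pow, Real.norm_eq_abs, sq_abs]
    linarith
  have h1 := mul_le_mul_of_nonneg_left hsmooth (div_pos hτ2 hτ).le
  have h2 := mul_le_mul_of_nonneg_left hconv
    (div_nonneg (mul_nonneg zero_le_two (sub_nonneg.2 hτ1)) hτ.le : 0 ≤ 2 * (1 - τ) / τ)
  have e8 : 1 / η * ‖r‖ ^ 2 = 1 / η * ‖u‖ ^ 2
      + 2 * (inner ℝ g u - α * inner ℝ w u + inner ℝ v u + α * ‖u‖ ^ 2)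
      + 2 * (1 / (2 * η) * ‖u - r‖ ^ 2) := by
    rw [e1, e2]; field_simp; ring
  have e9 : (2 - τ) / τ * Dg = 2 * (1 - τ) / τ * Dg + Dg := by field_simp; ring
  have e10 : 2 * (1 - τ) / τ * inner ℝ g s = 2 * ((1 - τ) / τ * inner ℝ g s) := by ring
  rw [e3, e8, e4, e5]
  linarith

/-- The terms left over in `accelerated_step_energy` control the new dual error `v`, because the
primal update expresses `v` through the three vectors that occur there. -/
theorem dual_error_le_leftover {L : ℝ} {r u w g v : E} (hη : 0 < η) (hα : 0 < α) (hL : 0 < L)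
    (hu : u - r = -η • (g - α • w + v + α • u)) :
    ‖v‖ ^ 2 ≤ (2 * L + 2 / η + α)
      * (1 / (2 * η) * ‖u - r‖ ^ 2 + α * ‖w - u‖ ^ 2 + 1 / (2 * L) * ‖g‖ ^ 2) := by
  have hv : v = α • (w - u) - η⁻¹ • (u - r) - g := by
    rw [hu, neg_smul, smul_neg, smul_smul, inv_mul_cancel₀ hη.ne']
    module
  have hn : ‖v‖ ≤ α * ‖w - u‖ + ‖u - r‖ / η + ‖g‖ := by
    rw [hv]
    refine (norm_sub_le _ _).trans (add_le_add_left ((norm_sub_le _ _).trans ?_) _)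
    rw [norm_smul, norm_smul, Real.norm_eq_abs, Real.norm_eq_abs, abs_of_pos hα,
      abs_of_pos (inv_pos.2 hη), div_eq_inv_mul]
  refine (pow_le_pow_left₀ (norm_nonneg v) hn 2).trans ?_
  generalize ‖w - u‖ = a
  generalize ‖g‖ = c
  generalize ‖u - r‖ = b
  -- Titu's lemma with the weights `α`, `2 / η`, `2 * L`
  have key : (2 * L + 2 / η + α) * (1 / (2 * η) * b ^ 2 + α * a ^ 2 + 1 / (2 * L) * c ^ 2)
      - (α * a + b / η + c) ^ 2
      = α * (2 / η) * (a - b / 2) ^ 2 + α * (2 * L) * (a - c / (2 * L)) ^ 2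
        + 2 / η * (2 * L) * (b / 2 - c / (2 * L)) ^ 2 := by
    field_simp; ring
  have : 0 ≤ α * (2 / η) * (a - b / 2) ^ 2 + α * (2 * L) * (a - c / (2 * L)) ^ 2
        + 2 / η * (2 * L) * (b / 2 - c / (2 * L)) ^ 2 := by positivity
  linarith

/-- One step of the primal-dual method contracts the Lyapunov function by the factor `1 + δ`. -/
theorem lyapunov_contraction {L τ δ Dg Df Df' : ℝ} {r u w g s s' ζ ζ' : E} (hη : 0 < η)
    (hα : 0 < α) (hL : 0 < L) (hτ : 0 < τ) (hτ1 : τ ≤ 1) (hηL : η = 1 / (4 * τ * L))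
    (hP : P.IsSymmetric) (hl₁ : 0 < l₁) (hl₂ : 0 < l₂)
    (hup : ∀ z, ‖P z‖ ^ 2 ≤ l₂ * inner ℝ z (P z))
    (hlow : ∀ z, l₁ * inner ℝ z (P z) ≤ ‖P z‖ ^ 2)
    (hδ : 0 ≤ δ) (hδτ : 2 * δ ≤ τ) (hδα : δ ≤ η * α)
    (hδl : δ * (η * (l₂ / l₁) * (2 * L + 2 / η + α)) ≤ 1)
    (hu : u - r = -η • (g - α • w + P ζ' + α • u))
    (hPu : P u = (η * l₂) • P (ζ' - ζ) - (η / (1 + η * α)) • P (P (ζ' - ζ)))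
    (hr : τ • (r - w) = -(1 - τ) • s)
    (hs' : s' = (2 * τ / (2 - τ)) • (u - r))
    (hcoc : 1 / (2 * L) * ‖g‖ ^ 2 ≤ Dg)
    (hmon : Dg + α / 2 * ‖w‖ ^ 2 ≤ inner ℝ g w)
    (hconv : inner ℝ g s ≤ Df - Dg)
    (hsmooth : Df' - Dg - L / 2 * ‖s'‖ ^ 2 ≤ inner ℝ g s') (hDf' : 0 ≤ Df') :
    (1 + δ) * (1 / η * ‖u‖ ^ 2 + 2 * (1 - τ) / τ * Df' + dualEnergy P η α l₂ ζ')
      ≤ 1 / η * ‖r‖ ^ 2 + 2 * (1 - τ) / τ * Df + dualEnergy P η α l₂ ζ := by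
  have h1 := accelerated_step_energy hη hL hτ hτ1 hηL hu hr hs' hcoc hmon hconv hsmooth
  have h2 := dualEnergy_step hP hη hα hup hPu
  have h3 := dual_error_le_leftover hη hα hL hu
  have h4 := dualEnergy_le hη hα hl₁ hl₂ hlow ζ'
  set R := 1 / (2 * η) * ‖u - r‖ ^ 2 + α * ‖w - u‖ ^ 2 + 1 / (2 * L) * ‖g‖ ^ 2 with hR
  have hR0 : 0 ≤ R := by positivity
  have h5 : δ * dualEnergy P η α l₂ ζ' ≤ R := by
    calc δ * dualEnergy P η α l₂ ζ'
        ≤ δ * (η * (l₂ / l₁) * ((2 * L + 2 / η + α) * R)) := by gcongr; exact h4.trans (by gcongr)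
      _ = δ * (η * (l₂ / l₁) * (2 * L + 2 / η + α)) * R := by ring
      _ ≤ 1 * R := by gcongr
      _ = R := one_mul R
  have h6 : (1 + δ) * (1 / η) ≤ 1 / η + α := by
    have : δ / η ≤ α := by rw [div_le_iff₀ hη]; linarith
    have e : (1 + δ) * (1 / η) = 1 / η + δ / η := by ring
    linarith
  have h7 : (1 + δ) * (2 * (1 - τ) / τ) ≤ (2 - τ) / τ := by
    rw [← mul_div_assoc]
    gcongr
    nlinarith
  have h8 := mul_le_mul_of_nonneg_right h6 (sq_nonneg ‖u‖)
  have h9 := mul_le_mul_of_nonneg_right h7 hDf'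
  linarith

end PrimalDual

namespace OPAPC

/-! ### Oracle programs -/

namespace Prog

variable {E α β : Type} (g w : E → E)

@[simp]
theorem eval_bind (p : Prog E α) (q : α → Prog E β) :
    (p.bind q).eval g w = (q (p.eval g w)).eval g w := by
  induction p with
  | ret a => rfl
  | grad x next ih => exact ih _
  | comm x next ih => exact ih _

@[simp]
theorem gradCount_bind (p : Prog E α) (q : α → Prog E β) :
    (p.bind q).gradCount g w = p.gradCount g w + (q (p.eval g w)).gradCount g w := by
  induction p with
  | ret a => simp [bind, gradCount, eval]
  | grad x next ih => simp only [bind, gradCount, eval, ih]; omega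
  | comm x next ih => simp only [bind, gradCount, eval, ih]

@[simp]
theorem commCount_bind (p : Prog E α) (q : α → Prog E β) :
    (p.bind q).commCount g w = p.commCount g w + (q (p.eval g w)).commCount g w := by
  induction p with
  | ret a => simp [bind, commCount, eval]
  | grad x next ih => simp only [bind, commCount, eval, ih]
  | comm x next ih => simp only [bind, commCount, eval, ih]; omega

end Prog

section Counts

variable {E : Type} [AddCommGroup E] [Module ℝ E] (g w : E → E)

theorem gradCount_chebyshevLoop (c₂ c₃ : ℝ) (m : ℕ) (a' a : ℝ) (z' z : E) :
    (chebyshevLoop c₂ c₃ m a' a z' z).gradCount g w = 0 := by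
  induction m generalizing a' a z' z with
  | zero => rfl
  | succ m ih => simp only [chebyshevLoop, Prog.gradCount, ih]

theorem commCount_chebyshevLoop (c₂ c₃ : ℝ) (m : ℕ) (a' a : ℝ) (z' z : E) :
    (chebyshevLoop c₂ c₃ m a' a z' z).commCount g w = m := by
  induction m generalizing a' a z' z with
  | zero => rfl
  | succ m ih => simp only [chebyshevLoop, Prog.commCount, ih]

theorem gradCount_acceleratedGossip (c₂ c₃ : ℝ) (T : ℕ) (x : E) :
    (acceleratedGossip c₂ c₃ T x).gradCount g w = 0 := by
  simp [acceleratedGossip, Prog.gradCount, gradCount_chebyshevLoop]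

theorem commCount_acceleratedGossip (c₂ c₃ : ℝ) {T : ℕ} (hT : 1 ≤ T) (x : E) :
    (acceleratedGossip c₂ c₃ T x).commCount g w = T := by
  simp [acceleratedGossip, Prog.commCount, commCount_chebyshevLoop, hT]

theorem gradCount_opapc (T : ℕ) (c₂ c₃ η θ α τ : ℝ) (x₀ y₀ : E) (k : ℕ) :
    (opapc T c₂ c₃ η θ α τ x₀ y₀ k).gradCount g w = k := by
  induction k with
  | zero => rfl
  | succ k ih => simp [opapc, ih, step, Prog.gradCount, gradCount_acceleratedGossip]

theorem commCount_opapc {T : ℕ} (hT : 1 ≤ T) (c₂ c₃ η θ α τ : ℝ) (x₀ y₀ : E) (k : ℕ) :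
    (opapc T c₂ c₃ η θ α τ x₀ y₀ k).commCount g w = k * T := by
  induction k with
  | zero => simp [opapc, Prog.commCount]
  | succ k ih =>
    simp [opapc, ih, step, Prog.commCount, commCount_acceleratedGossip g w c₂ c₃ hT, add_mul]

end Counts

/-! ### The Chebyshev polynomial behind accelerated gossip -/

/-- The polynomial `P` with `AcceleratedGossip(W, x, T) = P(W) x`, namely
`P(t) = 1 - T_T(c₂ (1 - c₃ t)) / T_T(c₂)` with the Chebyshev polynomial `T_T`. -/
noncomputable def gossipPoly (c₂ c₃ : ℝ) (T : ℕ) : ℝ[X] :=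
  1 - C ((Chebyshev.T ℝ T).eval c₂)⁻¹ * (Chebyshev.T ℝ T).comp (C c₂ * (1 - C c₃ * X))

theorem eval_gossipPoly (c₂ c₃ : ℝ) (T : ℕ) (t : ℝ) :
    (gossipPoly c₂ c₃ T).eval t
      = 1 - ((Chebyshev.T ℝ T).eval c₂)⁻¹ * (Chebyshev.T ℝ T).eval (c₂ * (1 - c₃ * t)) := by
  simp [gossipPoly]

section Eval

variable {E : Type} [AddCommGroup E] [Module ℝ E]

/-- Started from the Chebyshev values of degrees `i` and `i + 1`, the loop returns those of degree
`i + 1 + m`. -/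
theorem eval_chebyshevLoop (g : E → E) (W : E →ₗ[ℝ] E) (c₂ c₃ : ℝ) (x : E) (m i : ℕ) :
    (chebyshevLoop c₂ c₃ m ((Chebyshev.T ℝ i).eval c₂) ((Chebyshev.T ℝ (i + 1 : ℕ)).eval c₂)
        (aeval (c₂ • (1 - c₃ • W) : E →ₗ[ℝ] E) (Chebyshev.T ℝ i) x)
        (aeval (c₂ • (1 - c₃ • W) : E →ₗ[ℝ] E) (Chebyshev.T ℝ (i + 1 : ℕ)) x)).eval g W
      = ((Chebyshev.T ℝ (i + 1 + m : ℕ)).eval c₂,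
          aeval (c₂ • (1 - c₃ • W) : E →ₗ[ℝ] E) (Chebyshev.T ℝ (i + 1 + m : ℕ)) x) := by
  induction m generalizing i with
  | zero => rfl
  | succ m ih =>
    have hT : Chebyshev.T ℝ (i + 1 + 1 : ℕ)
        = 2 * X * Chebyshev.T ℝ (i + 1 : ℕ) - Chebyshev.T ℝ i := by
      push_cast
      rw [add_assoc, one_add_one_eq_two, Chebyshev.T_add_two]
    have h := ih (i + 1)
    have ha : (Chebyshev.T ℝ (i + 1 + 1 : ℕ)).eval c₂
        = 2 * c₂ * (Chebyshev.T ℝ (i + 1 : ℕ)).eval c₂ - (Chebyshev.T ℝ i).eval c₂ := by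
      rw [hT]; simp
    have hz : aeval (c₂ • (1 - c₃ • W) : E →ₗ[ℝ] E) (Chebyshev.T ℝ (i + 1 + 1 : ℕ)) x
        = (2 * c₂) • (aeval (c₂ • (1 - c₃ • W) : E →ₗ[ℝ] E) (Chebyshev.T ℝ (i + 1 : ℕ)) x
            - c₃ • W (aeval (c₂ • (1 - c₃ • W) : E →ₗ[ℝ] E) (Chebyshev.T ℝ (i + 1 : ℕ)) x))
          - aeval (c₂ • (1 - c₃ • W) : E →ₗ[ℝ] E) (Chebyshev.T ℝ i) x := by
      rw [hT]
      have h2 : (2 : ℝ[X]) = C 2 := rfl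
      rw [h2, map_sub, map_mul, map_mul, aeval_C, aeval_X]
      simp only [Module.End.mul_apply, Module.algebraMap_end_apply, mul_smul, LinearMap.sub_apply,
        LinearMap.smul_apply, Module.End.one_apply]
    rw [ha, hz] at h
    rw [show i + 1 + (m + 1) = i + 1 + 1 + m by ring]
    exact h

theorem eval_acceleratedGossip (g : E → E) (W : E →ₗ[ℝ] E) (c₂ c₃ : ℝ) {T : ℕ} (hT : 1 ≤ T)
    (x : E) :
    (acceleratedGossip c₂ c₃ T x).eval g W = aeval W (gossipPoly c₂ c₃ T) x := by
  have h := eval_chebyshevLoop g W c₂ c₃ x (T - 1) 0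
  have e : 0 + 1 + (T - 1) = T := by omega
  rw [e] at h
  simp only [Nat.cast_zero, Chebyshev.T_zero, zero_add, Nat.cast_one, Chebyshev.T_one, aeval_X,
    aeval_one, eval_one, eval_X, Module.End.one_apply, LinearMap.smul_apply, LinearMap.sub_apply] at h
  have hB : aeval W (C c₂ * (1 - C c₃ * X)) = (c₂ • (1 - c₃ • W) : E →ₗ[ℝ] E) := by
    simp only [map_mul, map_sub, map_one, aeval_C, aeval_X, Algebra.smul_def]
  simp only [acceleratedGossip, Prog.eval, Prog.eval_bind, h, gossipPoly]
  rw [map_sub, map_mul, aeval_comp, hB, aeval_C]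
  simp [Module.End.mul_apply, Module.algebraMap_end_apply]

/-- The dual iterates of OPAPC stay in the range of `P(W)`: with `y = P(W) z`, one iteration is the
update below of `x`, `x_f` and the preimage `z`. -/
theorem eval_step (g : E → E) (W : E →ₗ[ℝ] E) {T : ℕ} (hT : 1 ≤ T) (c₂ c₃ η θ α τ : ℝ)
    (s : State E) (z : E) (hy : s.y = aeval W (gossipPoly c₂ c₃ T) z) :
    ∃ z' : E, ∃ s' : State E, (step T c₂ c₃ η θ α τ s).eval g W = s' ∧
      s'.y = aeval W (gossipPoly c₂ c₃ T) z' ∧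
      z' = z + θ • (1 + η * α)⁻¹ • (s.x - η • (g (τ • s.x + (1 - τ) • s.xf)
        - α • (τ • s.x + (1 - τ) • s.xf) + s.y)) ∧
      s'.x = (1 + η * α)⁻¹ • (s.x - η • (g (τ • s.x + (1 - τ) • s.xf)
        - α • (τ • s.x + (1 - τ) • s.xf) + s'.y)) ∧
      s'.xf = τ • s.x + (1 - τ) • s.xf + (2 * τ / (2 - τ)) • (s'.x - s.x) := by
  refine ⟨_, _, rfl, ?_, rfl, ?_, ?_⟩ <;>
    simp [step, Prog.eval, eval_acceleratedGossip g W c₂ c₃ hT, hy]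

end Eval

theorem chebyshev_T_eval_add_inv_div_two {c : ℝ} (hc : c ≠ 0) (n : ℕ) :
    (Chebyshev.T ℝ n).eval ((c + c⁻¹) / 2) = (c ^ n + (c ^ n)⁻¹) / 2 := by
  induction n using Nat.twoStepInduction with
  | zero => simp
  | one => simp
  | more n h1 h2 =>
    have : ((n + 2 : ℕ) : ℤ) = (n : ℤ) + 2 := by push_cast; rfl
    push_cast at h2
    rw [this, Chebyshev.T_add_two]
    simp only [eval_sub, eval_mul, eval_ofNat, eval_X, h1, h2]
    field_simp
    ring

section Scalars

variable {χ lmax lmin c₁ c₂ c₃ : ℝ} {T : ℕ}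

theorem chebyshev_base_mem_Ioo (hχ : 1 < χ) (hc₁ : c₁ = (√χ - 1) / (√χ + 1)) :
    c₁ ∈ Set.Ioo (0 : ℝ) 1 := by
  have h1 : 1 < √χ := Real.lt_sqrt_of_sq_lt (by simpa using hχ)
  rw [hc₁]
  exact ⟨div_pos (by linarith) (by linarith), (div_lt_one (by linarith)).2 (by linarith)⟩

/-- `|T_T(c₂)| ≥ 1` because `c₂ > 1`, so the division in `gossipPoly` is a genuine one. -/
theorem eval_gossipPoly_zero (hχ : 1 < χ) (hc₂ : c₂ = (χ + 1) / (χ - 1)) :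
    (gossipPoly c₂ c₃ T).eval 0 = 0 := by
  have h1 : 1 ≤ |c₂| := by
    rw [hc₂]
    exact le_trans ((one_le_div (by linarith)).2 (by linarith)) (le_abs_self _)
  have h2 := Chebyshev.one_le_abs_eval_T_real T h1
  have h3 : (Chebyshev.T ℝ T).eval c₂ ≠ 0 := by
    intro h
    rw [h, abs_zero] at h2
    linarith
  rw [eval_gossipPoly, mul_zero, sub_zero, mul_one, inv_mul_cancel₀ h3, sub_self]

/-- On the positive spectrum the Chebyshev polynomial in `P` takes its argument in `[-1, 1]`, while
`T_T(c₂) = (c₁ ^ T + c₁ ^ (-T)) / 2` because `c₂ = (c₁ + c₁⁻¹) / 2`. -/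
theorem eval_gossipPoly_mem_Icc (hχ : 1 < χ) (hlmin : 0 < lmin) (hχl : χ = lmax / lmin)
    (hc₁ : c₁ = (√χ - 1) / (√χ + 1)) (hc₂ : c₂ = (χ + 1) / (χ - 1))
    (hc₃ : c₃ = 2 * χ / ((1 + χ) * lmax)) {t : ℝ} (h1 : lmin ≤ t) (h2 : t ≤ lmax) :
    (gossipPoly c₂ c₃ T).eval t ∈
      Set.Icc ((1 - c₁ ^ T) ^ 2 / (1 + c₁ ^ (2 * T))) ((1 + c₁ ^ T) ^ 2 / (1 + c₁ ^ (2 * T))) := by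
  obtain ⟨hc0, hc1⟩ := chebyshev_base_mem_Ioo hχ hc₁
  have hs1 : 1 < √χ := Real.lt_sqrt_of_sq_lt (by simpa using hχ)
  have hss : √χ ^ 2 = χ := Real.sq_sqrt (by linarith)
  have hc₂' : c₂ = (c₁ + c₁⁻¹) / 2 := by
    have : √χ - 1 ≠ 0 := by linarith
    have : √χ + 1 ≠ 0 := by linarith
    have : √χ ^ 2 - 1 ≠ 0 := by rw [hss]; linarith
    rw [hc₂, hc₁]
    generalize √χ = s at *
    rw [← hss]
    have : (s ^ 2 - 1) = (s - 1) * (s + 1) := by ring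
    rw [this]
    field_simp
    ring
  have hlm : lmax = χ * lmin := by rw [hχl]; field_simp
  have hc₃' : c₃ = 2 / ((1 + χ) * lmin) := by
    rw [hc₃, hlm]; field_simp
  have harg : |c₂ * (1 - c₃ * t)| ≤ 1 := by
    have e : c₂ * (1 - c₃ * t) = ((χ + 1) * lmin - 2 * t) / ((χ - 1) * lmin) := by
      have : χ - 1 ≠ 0 := by linarith
      have : 1 + χ ≠ 0 := by linarith
      rw [hc₂, hc₃']
      field_simp
      ring
    have hpos : 0 < (χ - 1) * lmin := mul_pos (by linarith) hlmin
    rw [e, abs_div, abs_of_pos hpos, div_le_one hpos, abs_le]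
    constructor <;> nlinarith
  have hT := abs_le.1 (Chebyshev.abs_eval_T_real_le_one T harg)
  have hq : 0 < c₁ ^ T := pow_pos hc0 T
  rw [eval_gossipPoly, hc₂', chebyshev_T_eval_add_inv_div_two hc0.ne', ← hc₂', pow_mul']
  generalize (Chebyshev.T ℝ T).eval (c₂ * (1 - c₃ * t)) = u at hT ⊢
  generalize c₁ ^ T = q at hq ⊢
  have e : ((q + q⁻¹) / 2)⁻¹ = 2 * q / (1 + q ^ 2) := by field_simp; ring
  have hq2 : 0 < 1 + q ^ 2 := by positivity
  rw [e, Set.mem_Icc, div_le_iff₀ hq2, le_div_iff₀ hq2]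
  have e2 : (1 - 2 * q / (1 + q ^ 2) * u) * (1 + q ^ 2) = 1 + q ^ 2 - 2 * q * u := by
    field_simp
  rw [e2]
  constructor <;> nlinarith [hT.1, hT.2]

/-- By Bernoulli's inequality `⌊√χ⌋` rounds bring the condition number of `P(W)` down to at most
`4`, that is `c₁ ^ T ≤ 1 / 3`. -/
theorem chebyshev_base_pow_floor_le (hχ : 1 < χ) (hc₁ : c₁ = (√χ - 1) / (√χ + 1))
    (hT : T = ⌊√χ⌋₊) : 1 ≤ T ∧ c₁ ^ T ≤ 1 / 3 := by
  obtain ⟨hc0, hc1⟩ := chebyshev_base_mem_Ioo hχ hc₁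
  have hs1 : 1 < √χ := Real.lt_sqrt_of_sq_lt (by simpa using hχ)
  have hT1 : 1 ≤ T := by rw [hT]; exact Nat.le_floor (by simpa using hs1.le)
  refine ⟨hT1, ?_⟩
  have hlt : √χ < T + 1 := by rw [hT]; exact Nat.lt_floor_add_one _
  have hT0 : (0 : ℝ) < T := by exact_mod_cast hT1
  have h1 : 1 + 2 / (T : ℝ) ≤ c₁⁻¹ := by
    have hd : 0 < √χ - 1 := by linarith
    rw [hc₁, inv_div, le_div_iff₀ hd, add_mul, one_mul, div_mul_eq_mul_div]
    have : 2 * (√χ - 1) / T ≤ 2 := by rw [div_le_iff₀ hT0]; linarith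
    linarith
  have h2 : (3 : ℝ) ≤ (c₁⁻¹) ^ T := by
    have hb := one_add_mul_le_pow (a := 2 / (T : ℝ)) (by have := div_pos two_pos hT0; linarith) T
    have e : 1 + (T : ℝ) * (2 / T) = 3 := by field_simp; norm_num
    rw [e] at hb
    exact hb.trans (pow_le_pow_left₀ (by positivity) h1 T)
  rw [inv_pow] at h2
  rw [one_div]
  exact (le_inv_comm₀ (by norm_num) (pow_pos hc0 T)).1 h2

/-- With `q = c₁ ^ T`, the ratio `(1 + q) / (1 - q)` lies in `[1, 2]`; this makes the step sizes
compatible with the contraction factor. -/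
theorem step_size_bounds {κ L μ q τ η δ : ℝ} (hκ : 1 ≤ κ) (hμ : 0 < μ) (hκL : L = κ * μ)
    (hq0 : 0 < q) (hq : q ≤ 1 / 3)
    (hτ : τ = min 1 ((1 + q) / (2 * √κ * (1 - q)))) (hη : η = 1 / (4 * τ * L))
    (hδ : δ = 1 / 16 * min (2 / √κ) 1) :
    0 < τ ∧ τ ≤ 1 ∧ 2 * δ ≤ τ ∧ δ ≤ η * μ ∧
      δ * (η * (((1 + q) ^ 2 / (1 + q ^ 2)) / ((1 - q) ^ 2 / (1 + q ^ 2)))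
        * (2 * L + 2 / η + μ)) ≤ 1 := by
  have hs1 : 1 ≤ √κ := Real.one_le_sqrt.2 hκ
  have hss : √κ ^ 2 = κ := Real.sq_sqrt (by linarith)
  have h1q : 0 < 1 - q := by linarith
  obtain ⟨r, hr⟩ : ∃ r, r = (1 + q) / (1 - q) := ⟨_, rfl⟩
  have hr1 : 1 ≤ r := by rw [hr, one_le_div h1q]; linarith
  have hr2 : r ≤ 2 := by rw [hr, div_le_iff₀ h1q]; linarith
  have hratio : ((1 + q) ^ 2 / (1 + q ^ 2)) / ((1 - q) ^ 2 / (1 + q ^ 2)) = r ^ 2 := by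
    rw [hr, div_pow]
    have : 1 + q ^ 2 ≠ 0 := by positivity
    field_simp
  have hτr : τ = min 1 (r / (2 * √κ)) := by
    rw [hτ, hr, div_div, mul_comm (1 - q)]
  rw [hratio]
  generalize √κ = s at *
  subst hss
  have hs0 : 0 < s := by linarith
  have hτle : τ ≤ r / (2 * s) := hτr ▸ min_le_right _ _
  have hτ1 : τ ≤ 1 := hτr ▸ min_le_left _ _
  have hτge : 1 / (2 * s) ≤ τ := by
    rw [hτr, le_min_iff]
    constructor
    · rw [div_le_one (by positivity)]; linarith
    · gcongr
  have hτ0 : 0 < τ := lt_of_lt_of_le (by positivity) hτge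
  have hL : 0 < L := by rw [hκL]; positivity
  have hδ1 : δ ≤ 1 / (8 * s) := by
    rw [hδ]
    calc 1 / 16 * min (2 / s) 1 ≤ 1 / 16 * (2 / s) := by gcongr; exact min_le_left _ _
      _ = 1 / (8 * s) := by field_simp; norm_num
  have hδ2 : δ ≤ 1 / 16 := by
    rw [hδ]
    calc 1 / 16 * min (2 / s) 1 ≤ 1 / 16 * 1 := by gcongr; exact min_le_right _ _
      _ = 1 / 16 := by norm_num
  have hδ0 : 0 < δ := by rw [hδ]; positivity
  have hημ : η * μ = 1 / (4 * τ * s ^ 2) := by rw [hη, hκL]; field_simp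
  have hτs : τ * s ≤ 1 := by
    calc τ * s ≤ r / (2 * s) * s := by gcongr
      _ = r / 2 := by field_simp
      _ ≤ 1 := by linarith
  refine ⟨hτ0, hτ1, ?_, ?_, ?_⟩
  · have : 2 * (1 / (8 * s)) ≤ 1 / (2 * s) := by
      rw [mul_one_div, div_le_div_iff₀ (by positivity) (by positivity)]; linarith
    linarith
  · refine hδ1.trans ?_
    rw [hημ]
    refine one_div_le_one_div_of_le (by positivity) ?_
    nlinarith [mul_le_mul_of_nonneg_right hτs hs0.le]
  · have e : η * r ^ 2 * (2 * L + 2 / η + μ)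
        = r ^ 2 / τ / 2 + 2 * r ^ 2 + r ^ 2 / τ / (4 * s ^ 2) := by
      rw [hη, hκL]; field_simp; ring
    -- `1 / τ = max 1 (2 s / r)`, hence `r² / τ = max r² (2 s r) ≤ 4 s`
    have hrτ : r ^ 2 / τ ≤ 4 * s := by
      rw [div_le_iff₀ hτ0]
      rcases min_choice 1 (r / (2 * s)) with h | h
      · rw [h] at hτr
        have : 1 ≤ r / (2 * s) := hτr ▸ hτle
        nlinarith
      · rw [h] at hτr
        rw [hτr]
        have : 4 * s * (r / (2 * s)) = 2 * r := by field_simp; norm_num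
        rw [this]; nlinarith
    have e3 : r ^ 2 / τ / (4 * s ^ 2) ≤ 1 / s := by
      rw [div_le_iff₀ (by positivity)]
      have : 1 / s * (4 * s ^ 2) = 4 * s := by field_simp
      linarith
    have hr4 : r ^ 2 ≤ 4 := by nlinarith
    rw [e]
    have hsum : r ^ 2 / τ / 2 + 2 * r ^ 2 + r ^ 2 / τ / (4 * s ^ 2) ≤ 2 * s + 8 + 1 / s := by
      linarith
    refine (mul_le_mul_of_nonneg_left hsum hδ0.le).trans ?_
    have his : 1 / s ≤ 1 := by rw [div_le_one hs0]; exact hs1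
    rcases le_total s 2 with h | h
    · calc δ * (2 * s + 8 + 1 / s) ≤ 1 / 16 * (2 * 2 + 8 + 1) := by gcongr
        _ ≤ 1 := by norm_num
    · calc δ * (2 * s + 8 + 1 / s) ≤ δ * (8 * s) := by gcongr; linarith
        _ ≤ 1 := by rwa [le_div_iff₀ (by positivity)] at hδ1

end Scalars

end OPAPC

/-! ### Polynomials in a symmetric operator and the spectrum of the gossip operator -/

section Spectral

variable {E : Type*} [NormedAddCommGroup E] [InnerProductSpace ℝ E] [FiniteDimensional ℝ E]
  {A : E →ₗ[ℝ] E} {p : ℝ[X]}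

namespace LinearMap.IsSymmetric

theorem repr_aeval (hA : A.IsSymmetric) (p : ℝ[X]) (z : E) (i : Fin (Module.finrank ℝ E)) :
    (hA.eigenvectorBasis rfl).repr (aeval A p z) i
      = p.eval (hA.eigenvalues rfl i) * (hA.eigenvectorBasis rfl).repr z i := by
  set b := hA.eigenvectorBasis rfl
  have hz : aeval A p z = ∑ j, b.repr z j • p.eval (hA.eigenvalues rfl j) • b j := by
    conv_lhs => rw [← b.sum_repr z, map_sum]
    refine Finset.sum_congr rfl fun j _ => ?_
    rw [map_smul, Module.End.aeval_apply_of_mem_apply_eq_smul (hA.apply_eigenvectorBasis rfl j)]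
    rfl
  have hs := b.sum_repr_symm
    (WithLp.toLp 2 fun j => b.repr z j * p.eval (hA.eigenvalues rfl j))
  simp only [← smul_smul] at hs
  rw [hz, hs, LinearIsometryEquiv.apply_symm_apply, mul_comm]

theorem inner_eq_sum_repr (hA : A.IsSymmetric) (x y : E) :
    inner ℝ x y
      = ∑ i, (hA.eigenvectorBasis rfl).repr x i * (hA.eigenvectorBasis rfl).repr y i := by
  rw [← (hA.eigenvectorBasis rfl).repr.inner_map_map, PiLp.inner_apply]
  simp [mul_comm]

theorem isSymmetric_aeval (hA : A.IsSymmetric) (p : ℝ[X]) :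
    (aeval A p : E →ₗ[ℝ] E).IsSymmetric := by
  intro x y
  simp only [hA.inner_eq_sum_repr, hA.repr_aeval]
  exact Finset.sum_congr rfl fun i _ => by ring

theorem norm_aeval_sq_le (hA : A.IsSymmetric) {M : ℝ}
    (hp : ∀ t, Module.End.HasEigenvalue A t → 0 ≤ p.eval t ∧ p.eval t ≤ M) (z : E) :
    ‖aeval A p z‖ ^ 2 ≤ M * inner ℝ z (aeval A p z) := by
  rw [← real_inner_self_eq_norm_sq]
  simp only [hA.inner_eq_sum_repr, hA.repr_aeval, Finset.mul_sum]
  refine Finset.sum_le_sum fun i _ => ?_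
  obtain ⟨h0, h1⟩ := hp _ (hA.hasEigenvalue_eigenvalues rfl i)
  have := mul_le_mul_of_nonneg_right (mul_le_mul_of_nonneg_left h1 h0)
    (sq_nonneg ((hA.eigenvectorBasis rfl).repr z i))
  simp only [RCLike.ofReal_real_eq_id, id_eq] at *
  linarith

theorem le_norm_aeval_sq (hA : A.IsSymmetric) {m : ℝ} (hm : 0 ≤ m)
    (hp : ∀ t, Module.End.HasEigenvalue A t → p.eval t = 0 ∨ m ≤ p.eval t) (z : E) :
    m * inner ℝ z (aeval A p z) ≤ ‖aeval A p z‖ ^ 2 := by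
  rw [← real_inner_self_eq_norm_sq]
  simp only [hA.inner_eq_sum_repr, hA.repr_aeval, Finset.mul_sum]
  refine Finset.sum_le_sum fun i _ => ?_
  rcases hp _ (hA.hasEigenvalue_eigenvalues rfl i) with h | h
  · simp only [RCLike.ofReal_real_eq_id, id_eq] at *
    simp [h]
  · have := mul_le_mul_of_nonneg_right (mul_le_mul_of_nonneg_left h (hm.trans h))
      (sq_nonneg ((hA.eigenvectorBasis rfl).repr z i))
    simp only [RCLike.ofReal_real_eq_id, id_eq] at *
    linarith

/-- If `p` has no nonzero root in the spectrum of `A`, the range of `p(A)` contains the orthogonal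
complement of the kernel of `A`. -/
theorem exists_aeval_eq (hA : A.IsSymmetric)
    (hp : ∀ t, Module.End.HasEigenvalue A t → t ≠ 0 → p.eval t ≠ 0) {v : E}
    (hv : ∀ x, A x = 0 → inner ℝ v x = 0) : ∃ z, aeval A p z = v := by
  set b := hA.eigenvectorBasis rfl with hb
  refine ⟨b.repr.symm (WithLp.toLp 2 fun i => (p.eval (hA.eigenvalues rfl i))⁻¹ * b.repr v i), ?_⟩
  apply b.repr.injective
  ext i
  rw [hA.repr_aeval, ← hb, LinearIsometryEquiv.apply_symm_apply]
  by_cases ht : hA.eigenvalues rfl i = 0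
  · have h0 : b.repr v i = 0 := by
      rw [b.repr_apply_apply, real_inner_comm]
      refine hv _ ?_
      rw [hb, hA.apply_eigenvectorBasis, ht]
      simp
    simp [h0]
  · exact mul_inv_cancel_left₀ (hp _ (hA.hasEigenvalue_eigenvalues rfl i) ht) _

end LinearMap.IsSymmetric

end Spectral

namespace OPAPC

section GossipOp

variable {n d : ℕ} {M : Matrix (Fin n) (Fin n) ℝ}

theorem inner_gossipOp (x y : Lifted n d) :
    inner ℝ x (gossipOp d M y) = ∑ t, (fun i => x i t) ⬝ᵥ M.mulVec (fun i => y i t) := by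
  simp only [gossipOp, LinearMap.coe_mk, AddHom.coe_mk, PiLp.inner_apply, dotProduct,
    Matrix.mulVec]
  rw [Finset.sum_comm]
  simp [mul_comm]

theorem gossipOp_isSymmetric (hM : M.PosSemidef) : (gossipOp d M).IsSymmetric := by
  intro x y
  rw [real_inner_comm, inner_gossipOp, inner_gossipOp]
  refine Finset.sum_congr rfl fun t _ => ?_
  have hMt : M.transpose = M := by simpa [Matrix.IsHermitian] using hM.isHermitian
  rw [Matrix.dotProduct_mulVec, ← Matrix.mulVec_transpose, hMt, dotProduct_comm]

theorem inner_gossipOp_nonneg (hM : M.PosSemidef) (x : Lifted n d) :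
    0 ≤ inner ℝ x (gossipOp d M x) := by
  rw [inner_gossipOp]
  exact Finset.sum_nonneg fun t _ => by simpa using hM.dotProduct_mulVec_nonneg (fun i => x i t)

end GossipOp

section Spectrum

variable {n d : ℕ} {W : Lifted n d →ₗ[ℝ] Lifted n d} {t : ℝ}

theorem le_lambdaMax (ht : Module.End.HasEigenvalue W t) : t ≤ lambdaMax W :=
  le_csSup (Module.End.finite_hasEigenvalue W).bddAbove ht

theorem lambdaMinPos_le (ht : Module.End.HasEigenvalue W t) (h0 : 0 < t) : lambdaMinPos W ≤ t :=
  csInf_le ⟨0, fun _ hs => hs.2.le⟩ ⟨ht, h0⟩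

theorem lambdaMinPos_pos_of_one_lt_chi (h : 1 < chi W) : 0 < lambdaMinPos W := by
  refine lt_of_le_of_ne (Real.sInf_nonneg fun _ hs => hs.2.le) fun h0 => ?_
  rw [chi, ← h0, div_zero] at h
  linarith

/-- `1 < χ(W)` excludes the trivial space, where there are no eigenvalues. -/
theorem nontrivial_of_one_lt_chi (h : 1 < chi W) : Nontrivial (Lifted n d) := by
  by_contra hc
  rw [not_nontrivial_iff_subsingleton] at hc
  have he : {t : ℝ | Module.End.HasEigenvalue W t ∧ 0 < t} = ∅ := by
    ext t
    simp only [Set.mem_ofPred_eq, Set.mem_empty_iff_false, iff_false, not_and]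
    intro ht
    obtain ⟨v, hv⟩ := ht.exists_hasEigenvector
    exact absurd (Subsingleton.elim v 0) hv.2
  have h0 := lambdaMinPos_pos_of_one_lt_chi h
  rw [lambdaMinPos, he, Real.sInf_empty] at h0
  exact lt_irrefl _ h0

theorem hasEigenvalue_nonneg (hW : ∀ x, 0 ≤ inner ℝ x (W x))
    (ht : Module.End.HasEigenvalue W t) : 0 ≤ t := by
  obtain ⟨v, hv⟩ := ht.exists_hasEigenvector
  have h := hW v
  rw [hv.apply_eq_smul, real_inner_smul_right, real_inner_self_eq_norm_sq] at h
  exact nonneg_of_mul_nonneg_left h (by have := norm_pos_iff.2 hv.2; positivity)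

end Spectrum

end OPAPC

namespace OPAPC

/-! ### Convergence of OPAPC -/

section Convergence

variable {n d : ℕ} {L μ : ℝ}

/-- On a nontrivial space the tangent paraboloids of curvature `μ` and `L` give `μ ≤ L`, so that
`L` is positive and `1 ≤ κ`. -/
theorem le_of_isSmoothStronglyConvex {f : Fin n → EuclideanSpace ℝ (Fin d) → ℝ}
    (hf : ∀ i, IsSmoothStronglyConvex L μ (f i)) [Nontrivial (Lifted n d)] : μ ≤ L := by
  obtain ⟨x, y, hxy⟩ := exists_pair_ne (Lifted n d)
  obtain ⟨i, hi⟩ : ∃ i, x i ≠ y i := by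
    by_contra h
    push Not at h
    exact hxy (PiLp.ext h)
  have h1 := strongConvexOn_lower_bound (hf i).strongConvex
    ((hf i).differentiable (y i)).hasGradientAt (x i)
  have h2 := lipschitz_gradient_upper_bound (hf i).differentiable (hf i).lipschitz_gradient
    (x i) (y i)
  have h3 : 0 < ‖x i - y i‖ ^ 2 := by
    have := norm_pos_iff.2 (sub_ne_zero.2 hi)
    positivity
  nlinarith

/-- First-order optimality: the gradient at the solution is orthogonal to the kernel of `W`. -/
theorem inner_gradient_eq_zero_of_isSolution {F : Lifted n d → ℝ} (hF : Differentiable ℝ F)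
    {W : Lifted n d →ₗ[ℝ] Lifted n d} {xstar : Lifted n d} (hsol : IsSolution F W xstar)
    {v : Lifted n d} (hv : W v = 0) : inner ℝ (gradient F xstar) v = 0 := by
  have hd : HasDerivAt (fun t : ℝ => F (xstar + t • v)) (inner ℝ (gradient F xstar) v) 0 :=
    hasDerivAt_comp_line_of_hasGradientAt (by simpa using (hF xstar).hasGradientAt)
  refine IsLocalMin.hasDerivAt_eq_zero (Filter.Eventually.of_forall fun t => ?_) hd
  simp only [zero_smul, add_zero]
  exact hsol.2 _ (by rw [map_add, map_smul, hsol.1, hv, smul_zero, add_zero])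

/-- The Lyapunov function at a state `s` with dual variable `y = P z`, relative to the solution
`xstar` with dual solution `P zstar`. -/
noncomputable def lyapunov (F : Lifted n d → ℝ) (P : Lifted n d →ₗ[ℝ] Lifted n d) (η α τ l₂ : ℝ)
    (xstar zstar : Lifted n d) (s : State (Lifted n d)) (z : Lifted n d) : ℝ :=
  1 / η * ‖s.x - xstar‖ ^ 2 + 2 * (1 - τ) / τ * bregman F s.xf xstar
    + dualEnergy P η α l₂ (z - zstar)

variable {F : Lifted n d → ℝ} {P : Lifted n d →ₗ[ℝ] Lifted n d} {η θ τ δ l₁ l₂ : ℝ}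
  {xstar zstar : Lifted n d}

theorem bregman_nonneg (hF : Differentiable ℝ F) (hFc : StrongConvexOn Set.univ μ F) (hμ : 0 < μ)
    (x y : Lifted n d) : 0 ≤ bregman F x y := by
  have h := strongConvexOn_lower_bound hFc (hF y).hasGradientAt x
  have : 0 ≤ μ / 2 * ‖x - y‖ ^ 2 := by positivity
  unfold bregman
  linarith

/-- One iteration of OPAPC contracts the Lyapunov function. Apart from the Bregman inequalities, the
point is that `P` annihilates the solution, so that the half step and the full step differ by a
multiple of `P (P (z' - z))` after applying `P`. -/
theorem lyapunov_step (hF : Differentiable ℝ F) (hFc : StrongConvexOn Set.univ μ F)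
    (hFL : ∀ x y, ‖gradient F x - gradient F y‖ ≤ L * ‖x - y‖) (hμ : 0 < μ) (hL : 0 < L)
    (hτ : 0 < τ) (hτ1 : τ ≤ 1) (hηL : η = 1 / (4 * τ * L)) (hθ : η * l₂ * θ = 1)
    (hP : P.IsSymmetric) (hl₁ : 0 < l₁) (hl₂ : 0 < l₂)
    (hup : ∀ z, ‖P z‖ ^ 2 ≤ l₂ * inner ℝ z (P z))
    (hlow : ∀ z, l₁ * inner ℝ z (P z) ≤ ‖P z‖ ^ 2)
    (hδ : 0 ≤ δ) (hδτ : 2 * δ ≤ τ) (hδμ : δ ≤ η * μ)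
    (hδl : δ * (η * (l₂ / l₁) * (2 * L + 2 / η + μ)) ≤ 1)
    (hPx : P xstar = 0) (hzstar : P zstar = -gradient F xstar)
    {s s' : State (Lifted n d)} {z z' xg : Lifted n d} (hy : s.y = P z) (hy' : s'.y = P z')
    (hxg : xg = τ • s.x + (1 - τ) • s.xf)
    (hz' : z' = z + θ • (1 + η * μ)⁻¹ • (s.x - η • (gradient F xg - μ • xg + s.y)))
    (hx' : s'.x = (1 + η * μ)⁻¹ • (s.x - η • (gradient F xg - μ • xg + s'.y)))
    (hxf' : s'.xf = xg + (2 * τ / (2 - τ)) • (s'.x - s.x)) :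
    (1 + δ) * lyapunov F P η μ τ l₂ xstar zstar s' z' ≤ lyapunov F P η μ τ l₂ xstar zstar s z := by
  have hη : 0 < η := by rw [hηL]; positivity
  have hβ : 1 + η * μ ≠ 0 := by positivity
  have hgs : gradient F xstar = -P zstar := by rw [hzstar, neg_neg]
  refine lyapunov_contraction (r := s.x - xstar) (u := s'.x - xstar) (w := xg - xstar)
    (g := gradient F xg - gradient F xstar) (s := s.xf - xg) (s' := s'.xf - xg)
    (Dg := bregman F xg xstar) (L := L) hη hμ hL hτ hτ1 hηL hP hl₁ hl₂ hup hlow hδ hδτ hδμ hδl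
    ?_ ?_ ?_ ?_ ?_ ?_ ?_ ?_ (bregman_nonneg hF hFc hμ _ _)
  · have h : (1 + η * μ) • s'.x = s.x - η • (gradient F xg - μ • xg + P z') := by
      rw [hx', smul_inv_smul₀ hβ, hy']
    have h2 : s'.x = s.x - η • (gradient F xg - μ • xg + P z') - (η * μ) • s'.x := by
      rw [← h]; module
    rw [hgs, map_sub]
    calc s'.x - xstar - (s.x - xstar) = s'.x - s.x := by abel
      _ = s.x - η • (gradient F xg - μ • xg + P z') - (η * μ) • s'.x - s.x := by rw [← h2]
      _ = _ := by module
  · have e1 : z' - zstar - (z - zstar)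
        = θ • (1 + η * μ)⁻¹ • (s.x - η • (gradient F xg - μ • xg + s.y)) := by rw [hz']; abel
    have e2 : z' - zstar - (z - zstar) = z' - z := by abel
    have e3 : s'.x = (1 + η * μ)⁻¹ • (s.x - η • (gradient F xg - μ • xg + s.y))
        - (η / (1 + η * μ)) • P (z' - z) := by
      rw [hx', hy', hy, map_sub]
      rw [div_eq_inv_mul]
      module
    rw [map_sub, hPx, sub_zero, e3, map_sub, map_smul P (η / (1 + η * μ)), e2]
    congr 1
    rw [← e2, e1, map_smul P θ, smul_smul, hθ, one_smul]
  · rw [hxg]; module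
  · rw [hxf']
    module
  · exact gradient_cocoercive (strongConvexOn_zero.1 (hFc.mono hμ.le)) hF hL hFL xg xstar
  · have h := strongConvexOn_lower_bound hFc (hF xg).hasGradientAt xstar
    rw [norm_sub_rev, ← neg_sub xg xstar, inner_neg_right] at h
    rw [bregman, inner_sub_left]
    linarith
  · have h := strongConvexOn_lower_bound (hFc.mono hμ.le) (hF xg).hasGradientAt s.xf
    have e : s.xf - xg = (s.xf - xstar) - (xg - xstar) := by abel
    rw [bregman, bregman, inner_sub_left]
    have h2 : inner ℝ (gradient F xstar) (s.xf - xg)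
        = inner ℝ (gradient F xstar) (s.xf - xstar) - inner ℝ (gradient F xstar) (xg - xstar) := by
      rw [e, inner_sub_right]
    linarith
  · have h := lipschitz_gradient_upper_bound hF hFL s'.xf xg
    have e : s'.xf - xg = (s'.xf - xstar) - (xg - xstar) := by abel
    rw [bregman, bregman, inner_sub_left]
    have h2 : inner ℝ (gradient F xstar) (s'.xf - xg)
        = inner ℝ (gradient F xstar) (s'.xf - xstar)
          - inner ℝ (gradient F xstar) (xg - xstar) := by
      rw [e, inner_sub_right]
    linarith

/-- Linear convergence of OPAPC for an operator `W` whose gossip polynomial `P(W)` has its nonzero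
spectrum in `[l₁, l₂]`. -/
theorem opapc_linear_convergence (hF : Differentiable ℝ F) (hFc : StrongConvexOn Set.univ μ F)
    (hFL : ∀ x y, ‖gradient F x - gradient F y‖ ≤ L * ‖x - y‖) (hμ : 0 < μ) (hL : 0 < L)
    (hτ : 0 < τ) (hτ1 : τ ≤ 1) (hηL : η = 1 / (4 * τ * L)) (hθ : η * l₂ * θ = 1)
    {W : Lifted n d →ₗ[ℝ] Lifted n d} {T : ℕ} (hT : 1 ≤ T) {c₂ c₃ : ℝ}
    (hPW : P = aeval W (gossipPoly c₂ c₃ T))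
    (hP : P.IsSymmetric) (hl₁ : 0 < l₁) (hl₂ : 0 < l₂)
    (hup : ∀ z, ‖P z‖ ^ 2 ≤ l₂ * inner ℝ z (P z))
    (hlow : ∀ z, l₁ * inner ℝ z (P z) ≤ ‖P z‖ ^ 2)
    (hδ : 0 ≤ δ) (hδτ : 2 * δ ≤ τ) (hδμ : δ ≤ η * μ)
    (hδl : δ * (η * (l₂ / l₁) * (2 * L + 2 / η + μ)) ≤ 1)
    (hPx : P xstar = 0) (hzstar : P zstar = -gradient F xstar) (x₀ z₀ : Lifted n d) :
    ∃ C : ℝ, 0 ≤ C ∧ ∀ k : ℕ,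
      1 / η * ‖((opapc T c₂ c₃ η θ μ τ x₀ (P z₀) k).eval (gradient F) W).x - xstar‖ ^ 2
        + 2 * (1 - τ) / τ
          * bregman F ((opapc T c₂ c₃ η θ μ τ x₀ (P z₀) k).eval (gradient F) W).xf xstar
        ≤ ((1 + δ) ^ k)⁻¹ * C := by
  have hη : 0 < η := by rw [hηL]; positivity
  have key : ∀ k : ℕ, ∃ z,
      ((opapc T c₂ c₃ η θ μ τ x₀ (P z₀) k).eval (gradient F) W).y = P z ∧
      (1 + δ) ^ k * lyapunov F P η μ τ l₂ xstar zstar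
          ((opapc T c₂ c₃ η θ μ τ x₀ (P z₀) k).eval (gradient F) W) z
        ≤ lyapunov F P η μ τ l₂ xstar zstar ⟨x₀, x₀, P z₀⟩ z₀ := by
    intro k
    induction k with
    | zero => exact ⟨z₀, rfl, by simp [opapc, Prog.eval]⟩
    | succ k ih =>
      obtain ⟨z, hy, hle⟩ := ih
      obtain ⟨z', s', hs', hy', hz', hx', hxf'⟩ :=
        eval_step (gradient F) W hT c₂ c₃ η θ μ τ _ z (hy.trans (by rw [hPW]))
      have hstep := lyapunov_step hF hFc hFL hμ hL hτ hτ1 hηL hθ hP hl₁ hl₂ hup hlow hδ hδτ hδμ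
        hδl hPx hzstar hy (hy'.trans (by rw [hPW])) rfl hz' hx' hxf'
      refine ⟨z', ?_, ?_⟩
      · rw [opapc, Prog.eval_bind, hs', hPW, hy']
      · rw [opapc, Prog.eval_bind, hs', pow_succ, mul_assoc]
        exact (mul_le_mul_of_nonneg_left hstep (by positivity)).trans hle
  have hcoef : 0 ≤ 2 * (1 - τ) / τ :=
    div_nonneg (mul_nonneg zero_le_two (sub_nonneg.2 hτ1)) hτ.le
  refine ⟨lyapunov F P η μ τ l₂ xstar zstar ⟨x₀, x₀, P z₀⟩ z₀, ?_, fun k => ?_⟩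
  · have h1 := mul_nonneg hcoef (bregman_nonneg hF hFc hμ x₀ xstar)
    have h2 := dualEnergy_nonneg hη hμ hup (z₀ - zstar)
    have h3 : 0 ≤ 1 / η * ‖x₀ - xstar‖ ^ 2 := by positivity
    simp only [lyapunov]
    linarith
  · obtain ⟨z, -, hle⟩ := key k
    have h2 := dualEnergy_nonneg hη hμ hup (z - zstar)
    rw [le_inv_mul_iff₀ (by positivity)]
    refine le_trans (mul_le_mul_of_nonneg_left ?_ (by positivity)) hle
    unfold lyapunov
    linarith

end Convergence

/-! ### Complexity -/

section Complexity

/-- A sequence bounded by `A (1 + δ)^{-k}` is below `ε` after `O(δ⁻¹ log (A / ε))` steps; here `s`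
stands for `√κ`. -/
theorem exists_iteration_count {e : ℕ → ℝ} {A s δ ε : ℝ} (hs : 1 ≤ s) (hA : 0 ≤ A) (hε : 0 < ε)
    (hδ : δ = 1 / 16 * min (2 / s) 1) (he : ∀ k, e k ≤ ((1 + δ) ^ k)⁻¹ * A) :
    ∃ k : ℕ, (∀ j, k ≤ j → e j ≤ ε) ∧ (k : ℝ) ≤ 17 * s * (1 + max 0 (Real.log (A / ε))) := by
  have hs0 : 0 < s := by linarith
  have hδ0 : 0 < δ := by rw [hδ]; positivity
  have hδ1 : δ ≤ 1 / 16 := by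
    rw [hδ]; linarith [min_le_right (2 / s) (1 : ℝ)]
  have hδs : 1 ≤ 16 * s * δ := by
    have h : 1 ≤ s * min (2 / s) 1 := by
      rcases min_choice (2 / s) 1 with h | h
      · rw [h, mul_div_cancel₀ _ hs0.ne']; norm_num
      · rw [h]; linarith
    calc (1 : ℝ) ≤ s * min (2 / s) 1 := h
      _ = 16 * s * δ := by rw [hδ]; ring
  -- the truncation at `0` also covers `A = 0`, where `log (A / ε)` is a junk value
  set m := max 0 (Real.log (A / ε)) with hm
  have hm0 : 0 ≤ m := le_max_left _ _
  have hlog : δ * (16 / 17) ≤ Real.log (1 + δ) := by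
    have h1 := Real.one_sub_inv_le_log_of_pos (show 0 < 1 + δ by linarith)
    have h2 : 1 - (1 + δ)⁻¹ = δ * (1 + δ)⁻¹ := by field_simp; ring
    have h3 : (16 / 17 : ℝ) ≤ (1 + δ)⁻¹ := by
      rw [le_inv_comm₀ (by norm_num) (by linarith)]; linarith
    rw [h2] at h1
    exact (mul_le_mul_of_nonneg_left h3 hδ0.le).trans h1
  have hlog0 : 0 < Real.log (1 + δ) := lt_of_lt_of_le (by positivity) hlog
  have hinv : m / Real.log (1 + δ) ≤ 17 * s * m := by
    rw [div_le_iff₀ hlog0]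
    have h1 : 1 ≤ 17 * s * Real.log (1 + δ) := by nlinarith
    nlinarith
  have hAε : A / ε ≤ Real.exp m := by
    rcases hA.eq_or_lt with h | h
    · rw [← h, zero_div]; positivity
    · rw [← Real.log_le_iff_le_exp (by positivity)]; exact le_max_right _ _
  refine ⟨⌈m / Real.log (1 + δ)⌉₊, fun j hj => ?_, ?_⟩
  · have h1 : m ≤ j * Real.log (1 + δ) := by
      rw [← div_le_iff₀ hlog0]; exact Nat.ceil_le.1 hj
    have h2 : Real.exp m ≤ (1 + δ) ^ j := by
      rw [← Real.log_pow] at h1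
      rwa [Real.le_log_iff_exp_le (by positivity)] at h1
    refine (he j).trans ?_
    rw [inv_mul_le_iff₀ (by positivity)]
    have h3 := hAε.trans h2
    rwa [div_le_iff₀ hε] at h3
  · have h1 := (Nat.ceil_lt_add_one (div_nonneg hm0 hlog0.le)).le
    nlinarith

/-- For small `ε` the constants are absorbed by `log (1 / ε)`. -/
theorem exists_forall_one_add_log_le {A : ℝ} (hA : 0 ≤ A) :
    ∃ ε₀ : ℝ, 0 < ε₀ ∧ ∀ ε : ℝ, 0 < ε → ε ≤ ε₀ →
      1 + max 0 (Real.log (A / ε)) ≤ 3 * Real.log (1 / ε) := by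
  have hB : 0 < max (Real.exp 1) A := lt_of_lt_of_le (Real.exp_pos 1) (le_max_left _ _)
  refine ⟨1 / max (Real.exp 1) A, by positivity, fun ε hε hle => ?_⟩
  have h1 : max (Real.exp 1) A ≤ 1 / ε := (le_one_div hε hB).1 hle
  have h2 : 1 ≤ Real.log (1 / ε) := by
    rw [Real.le_log_iff_exp_le (by positivity)]
    exact (le_max_left _ _).trans h1
  have h3 : Real.log (A / ε) ≤ 2 * Real.log (1 / ε) := by
    rcases hA.eq_or_lt with h | h
    · rw [← h, zero_div, Real.log_zero]; linarith
    · rw [div_eq_mul_one_div, Real.log_mul h.ne' (by positivity)]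
      have := Real.log_le_log h ((le_max_right _ _).trans h1)
      linarith
  have h4 : max 0 (Real.log (A / ε)) ≤ 2 * Real.log (1 / ε) := max_le (by linarith) h3
  linarith

end Complexity

end OPAPC

/-! ### The complexity theorem -/

theorem corollary3 :
    -- `K` is the absolute constant in the two complexity bounds
    ∃ K : ℝ, 0 < K ∧
    ∀ (n d : ℕ) (G : SimpleGraph (Fin n)) (_ : G.Connected)
      (M : Matrix (Fin n) (Fin n) ℝ) (_ : OPAPC.IsGossipMatrix G M)
      (W : OPAPC.Lifted n d →ₗ[ℝ] OPAPC.Lifted n d) (_ : W = OPAPC.gossipOp d M)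
      (L μ : ℝ) (_ : 0 < μ)
      (f : Fin n → EuclideanSpace ℝ (Fin d) → ℝ)
      (_ : ∀ i, OPAPC.IsSmoothStronglyConvex L μ (f i))
      (F : OPAPC.Lifted n d → ℝ) (_ : F = OPAPC.sumObjective f)
      (xstar : OPAPC.Lifted n d) (_ : OPAPC.IsSolution F W xstar)
      (κ χ : ℝ) (_ : κ = L / μ) (_ : χ = OPAPC.chi W) (_ : 1 < χ)
      -- the parameters
      (T : ℕ) (c₁ c₂ c₃ η θ α τ : ℝ)
      (_ : T = ⌊√χ⌋₊)
      (_ : c₁ = (√χ - 1) / (√χ + 1))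
      (_ : c₂ = (χ + 1) / (χ - 1))
      (_ : c₃ = 2 * χ / ((1 + χ) * OPAPC.lambdaMax W))
      (_ : η = 1 / (4 * τ * L))
      (_ : θ = (1 + c₁ ^ (2 * T)) / (η * (1 + c₁ ^ T) ^ 2))
      (_ : α = μ)
      (_ : τ = min 1 ((1 + c₁ ^ T) / (2 * √κ * (1 - c₁ ^ T))))
      -- the starting point, with `y₀` in the range of `P(W)`
      (x₀ y₀ : OPAPC.Lifted n d)
      (_ : ∃ z, y₀ = (OPAPC.acceleratedGossip c₂ c₃ T z).eval (gradient F) W)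
      -- `run k` is the program that performs `k` iterations
      (run : ℕ → OPAPC.Prog (OPAPC.Lifted n d) (OPAPC.State (OPAPC.Lifted n d)))
      (_ : run = OPAPC.opapc T c₂ c₃ η θ α τ x₀ y₀)
      (x xf : ℕ → OPAPC.Lifted n d)
      (_ : ∀ k, x k = ((run k).eval (gradient F) W).x)
      (_ : ∀ k, xf k = ((run k).eval (gradient F) W).xf),
    ∃ C : ℝ, 0 ≤ C ∧
      -- linear convergence
      (∀ k : ℕ,
        1 / η * ‖x k - xstar‖ ^ 2 + 2 * (1 - τ) / τ * OPAPC.bregman F (xf k) xstar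
          ≤ ((1 + 1 / 16 * min (2 / √κ) 1) ^ k)⁻¹ * C) ∧
      -- complexity, explicit for every accuracy
      (∀ ε : ℝ, 0 < ε → ∃ k : ℕ, (∀ j, k ≤ j → ‖x j - xstar‖ ^ 2 ≤ ε) ∧
        ((run k).gradCount (gradient F) W : ℝ)
          ≤ K * √κ * (1 + max 0 (Real.log (η * C / ε))) ∧
        ((run k).commCount (gradient F) W : ℝ)
          ≤ K * √(κ * χ) * (1 + max 0 (Real.log (η * C / ε)))) ∧
      -- complexity, in the form `O(log (1 / ε))`
      (∃ ε₀ : ℝ, 0 < ε₀ ∧ ∀ ε : ℝ, 0 < ε → ε ≤ ε₀ →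
        ∃ k : ℕ, (∀ j, k ≤ j → ‖x j - xstar‖ ^ 2 ≤ ε) ∧
        ((run k).gradCount (gradient F) W : ℝ) ≤ K * √κ * Real.log (1 / ε) ∧
        ((run k).commCount (gradient F) W : ℝ) ≤ K * √(κ * χ) * Real.log (1 / ε)) := by
  refine ⟨51, by norm_num, ?_⟩
  intro n d G _ M hM W hW L μ hμ f hf F hF xstar hsol κ χ hκ hχ hχ1 T c₁ c₂ c₃ η θ α τ hT hc₁ hc₂
    hc₃ hη hθ hα hτ x₀ y₀ hy₀ run hrun x xf hx hxf
  rw [hα] at hrun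
  have hχ1' : 1 < OPAPC.chi W := hχ ▸ hχ1
  have := OPAPC.nontrivial_of_one_lt_chi hχ1'
  have hμL := OPAPC.le_of_isSmoothStronglyConvex hf
  have hL : 0 < L := hμ.trans_le hμL
  have hκ1 : 1 ≤ κ := by rw [hκ, one_le_div hμ]; exact hμL
  have hκL : L = κ * μ := by rw [hκ]; field_simp
  have hFd : Differentiable ℝ F := fun z => by
    rw [hF]
    exact (OPAPC.hasGradientAt_sumObjective (fun i => (hf i).differentiable) z).differentiableAt
  have hFc : StrongConvexOn Set.univ μ F := by
    rw [hF]
    exact OPAPC.strongConvexOn_sumObjective fun i => (hf i).strongConvex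
  have hFL : ∀ a b, ‖gradient F a - gradient F b‖ ≤ L * ‖a - b‖ := by
    rw [hF]
    exact OPAPC.gradient_sumObjective_lipschitz hL.le (fun i => (hf i).differentiable)
      fun i => (hf i).lipschitz_gradient
  have hWs : W.IsSymmetric := hW ▸ OPAPC.gossipOp_isSymmetric hM.posSemidef
  have hWp : ∀ z, 0 ≤ inner ℝ z (W z) := by
    rw [hW]; exact OPAPC.inner_gossipOp_nonneg hM.posSemidef
  have hmin := OPAPC.lambdaMinPos_pos_of_one_lt_chi hχ1'
  obtain ⟨hc0, hc1⟩ := OPAPC.chebyshev_base_mem_Ioo hχ1 hc₁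
  obtain ⟨hT1, hq⟩ := OPAPC.chebyshev_base_pow_floor_le hχ1 hc₁ hT
  have hq0 : 0 < c₁ ^ T := pow_pos hc0 T
  have h1q : 0 < 1 - c₁ ^ T := by linarith
  have hp0 : (OPAPC.gossipPoly c₂ c₃ T).eval 0 = 0 := OPAPC.eval_gossipPoly_zero hχ1 hc₂
  have hl₁ : 0 < (1 - c₁ ^ T) ^ 2 / (1 + c₁ ^ (2 * T)) := by positivity
  have hl₂ : 0 < (1 + c₁ ^ T) ^ 2 / (1 + c₁ ^ (2 * T)) := by positivity
  have hp : ∀ t, Module.End.HasEigenvalue W t → t ≠ 0 →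
      (OPAPC.gossipPoly c₂ c₃ T).eval t ∈ Set.Icc ((1 - c₁ ^ T) ^ 2 / (1 + c₁ ^ (2 * T)))
        ((1 + c₁ ^ T) ^ 2 / (1 + c₁ ^ (2 * T))) := fun t ht h0 =>
    OPAPC.eval_gossipPoly_mem_Icc hχ1 hmin hχ hc₁ hc₂ hc₃
      (OPAPC.lambdaMinPos_le ht ((OPAPC.hasEigenvalue_nonneg hWp ht).lt_of_ne' h0))
      (OPAPC.le_lambdaMax ht)
  -- the spectrum of `W` is contained in `{0} ∪ [λ_min⁺, λ_max]`, and `P(0) = 0`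
  have hup := hWs.norm_aeval_sq_le (p := OPAPC.gossipPoly c₂ c₃ T)
    (M := (1 + c₁ ^ T) ^ 2 / (1 + c₁ ^ (2 * T))) fun t ht => by
      by_cases h0 : t = 0
      · rw [h0, hp0]; exact ⟨le_rfl, hl₂.le⟩
      · exact ⟨hl₁.le.trans (hp t ht h0).1, (hp t ht h0).2⟩
  have hlow := hWs.le_norm_aeval_sq (p := OPAPC.gossipPoly c₂ c₃ T) hl₁.le fun t ht => by
      by_cases h0 : t = 0
      · left; rw [h0, hp0]
      · right; exact (hp t ht h0).1
  -- `-∇F(x*)` is orthogonal to `ker W`, so it is the image of a dual solution under `P(W)`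
  obtain ⟨zstar, hzstar⟩ := hWs.exists_aeval_eq (p := OPAPC.gossipPoly c₂ c₃ T)
    (v := -gradient F xstar) (fun t ht h0 => (hl₁.trans_le (hp t ht h0).1).ne') fun v hv => by
      rw [inner_neg_left, OPAPC.inner_gradient_eq_zero_of_isSolution hFd hsol hv, neg_zero]
  have hPx : Polynomial.aeval W (OPAPC.gossipPoly c₂ c₃ T) xstar = 0 := by
    rw [Module.End.aeval_apply_of_mem_apply_eq_smul (μ := (0 : ℝ)) (by rw [hsol.1, zero_smul]),
      hp0, zero_smul]
  set δ := 1 / 16 * min (2 / √κ) 1 with hδ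
  obtain ⟨hτ0, hτ1, hδτ, hδμ, hδl⟩ := OPAPC.step_size_bounds hκ1 hμ hκL hq0 hq hτ hη hδ
  rw [← pow_mul, mul_comm T 2] at hδl
  have hη0 : 0 < η := by rw [hη]; positivity
  have hδ0 : 0 ≤ δ := by
    have := Real.sqrt_nonneg κ
    positivity
  have hθ1 : η * ((1 + c₁ ^ T) ^ 2 / (1 + c₁ ^ (2 * T))) * θ = 1 := by
    rw [hθ]
    have : 1 + c₁ ^ (2 * T) ≠ 0 := by positivity
    field_simp
  obtain ⟨z₀, hz₀⟩ := hy₀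
  rw [OPAPC.eval_acceleratedGossip _ _ _ _ hT1] at hz₀
  obtain ⟨C, hC, hconv⟩ := OPAPC.opapc_linear_convergence hFd hFc hFL hμ hL hτ0 hτ1 hη hθ1 hT1 rfl
    (hWs.isSymmetric_aeval _) hl₁ hl₂ hup hlow hδ0 hδτ hδμ hδl hPx hzstar x₀ z₀
  rw [← hz₀, ← hrun] at hconv
  simp only [← hx, ← hxf] at hconv
  have hs1 : 1 ≤ √κ := Real.one_le_sqrt.2 hκ1
  have hgrad : ∀ k, ((run k).gradCount (gradient F) W : ℝ) = k := fun k => by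
    rw [hrun, OPAPC.gradCount_opapc]
  have hcomm : ∀ k, ((run k).commCount (gradient F) W : ℝ) ≤ k * √χ := fun k => by
    rw [hrun, OPAPC.commCount_opapc _ _ hT1, Nat.cast_mul, hT]
    exact mul_le_mul_of_nonneg_left (Nat.floor_le (Real.sqrt_nonneg χ)) (Nat.cast_nonneg k)
  have hdist : ∀ k, ‖x k - xstar‖ ^ 2 ≤ ((1 + δ) ^ k)⁻¹ * (η * C) := fun k => by
    have h1 := hconv k
    have h2 : 0 ≤ 2 * (1 - τ) / τ * OPAPC.bregman F (xf k) xstar :=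
      mul_nonneg (div_nonneg (mul_nonneg zero_le_two (sub_nonneg.2 hτ1)) hτ0.le)
        (OPAPC.bregman_nonneg hFd hFc hμ _ _)
    have h3 : 1 / η * ‖x k - xstar‖ ^ 2 ≤ ((1 + δ) ^ k)⁻¹ * C := by linarith
    rw [one_div, inv_mul_le_iff₀ hη0] at h3
    linarith
  have hηC : 0 ≤ η * C := mul_nonneg hη0.le hC
  have hcount : ∀ ε : ℝ, 0 < ε → ∃ k : ℕ, (∀ j, k ≤ j → ‖x j - xstar‖ ^ 2 ≤ ε) ∧
      ((run k).gradCount (gradient F) W : ℝ)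
        ≤ 17 * √κ * (1 + max 0 (Real.log (η * C / ε))) ∧
      ((run k).commCount (gradient F) W : ℝ)
        ≤ 17 * √(κ * χ) * (1 + max 0 (Real.log (η * C / ε))) := fun ε hε => by
    obtain ⟨k, hk1, hk2⟩ := OPAPC.exists_iteration_count hs1 hηC hε hδ hdist
    refine ⟨k, hk1, (hgrad k).trans_le hk2, (hcomm k).trans ?_⟩
    rw [Real.sqrt_mul (by linarith)]
    exact (mul_le_mul_of_nonneg_right hk2 (Real.sqrt_nonneg χ)).trans_eq (by ring)
  refine ⟨C, hC, hconv, fun ε hε => ?_, ?_⟩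
  · obtain ⟨k, hk, hg, hc⟩ := hcount ε hε
    have hm : 0 ≤ 1 + max 0 (Real.log (η * C / ε)) := by positivity
    refine ⟨k, hk, hg.trans ?_, hc.trans ?_⟩ <;> gcongr <;> norm_num
  · obtain ⟨ε₀, hε₀, hlog⟩ := OPAPC.exists_forall_one_add_log_le hηC
    refine ⟨ε₀, hε₀, fun ε hε hle => ?_⟩
    obtain ⟨k, hk, hg, hc⟩ := hcount ε hε
    have hl := hlog ε hε hle
    refine ⟨k, hk, hg.trans ?_, hc.trans ?_⟩
    · exact (mul_le_mul_of_nonneg_left hl (by positivity)).trans_eq (by ring)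
    · exact (mul_le_mul_of_nonneg_left hl (by positivity)).trans_eq (by ring)
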